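/- Let $N\in\mathbb N$. A \emph{weight function} is a continuous increasing (i.e. nondecreasing) function $\omega:[0,\infty)\to[0,\infty)$ such that: ($\alpha$) there is $K\ge 1$ with $\omega(2x)\le K(1+\omega(x))$ for all $x\ge 0$; ($\beta$) $\omega(x)=o(x)$ as $x\to\infty$; ($\gamma$) there are $a\in\mathbb R$, $b>0$ with $\omega(x)\ge a+b\log(1+x)$ for all $x\ge0$; ($\delta$) $x\mapsto\omega(e^x)$ is convex on $\mathbb R$. Let $\omega_1,\dots,\omega_N,\sigma_1,\dots,\sigma_N$ be weight functions and put $\Omega(x)=\sum_{j=1}^N\omega_j(|x_j|)$, $\Sigma(x)=\sum_{j=1}^N\sigma_j(|x_j|)$ for $x\in\mathbb R^N$. With $\hat f(\xi)=\int_{\mathbb R^N}e^{-ix\cdot\xi}f(x)\,dx$ and $D_j=-i\partial_j$, let $\mathcal S_\Omega^\Sigma(\mathbb R^N)$ be the space of all $f\in L^1(\mathbb R^N)$ such that $f,\hat f\in C^\infty(\mathbb R^N)$ and $$\|e^{\lambda\Omega}D^\alpha f\|_\infty<\infty,\qquad \|e^{\lambda\Sigma}D^\alpha\hat f\|_\infty<\infty\qquad\text{for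 all }\lambda>0,\ \alpha\in\mathbb N_0^N,$$ with the Fréchet topology given by the seminorms $\|e^{n\Omega}D^\alpha f\|_\infty$ and $\|e^{n\Sigma}D^\alpha\hat f\|_\infty$ ($n\in\mathbb N$, $n\geq 1$, $\alpha\in\mathbb N_0^N$). Let $(\mathcal S_\Omega^\Sigma)'(\mathbb R^N)$ be the space of continuous linear maps $\mathcal S_\Omega^\Sigma(\mathbb R^N)\to\mathbb C$; a function $h\in\mathcal S_\Omega^\Sigma(\mathbb R^N)$ is identified with the functional $\varphi\mapsto\int_{\mathbb R^N} h(t)\varphi(t)\,dt$. For $g\in\mathcal S_\Omega^\Sigma(\mathbb R^N)$ and $f\in(\mathcal S_\Omega^\Sigma)'(\mathbb R^N)$ the short-time Fourier transform is $$V_gf(x,\xi)=\big\langle f,\ e^{-i\,t\cdot\xi}\,\overline{g(t-x)}\big\rangle_t,\qquad x,\xi\in\mathbb R^N .$$ \textbf{Theorem.} Let $g\in\mathcal S_\Omega^\Sigma(\mathbb R^N)$, $g\ne0$, and let $f\in(\mathcal S_\Omega^\Sigma)'(\mathbb R^N)$. The following conditions are equivalent: (1) $f\in\mathcal S_\Omega^\Sigma(\mathbb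 R^N)$; (2) for every $\lambda>0$ there is a constant $C_\lambda>0$ such that $$|V_gf(x,\xi)|\le C_\lambda\,e^{-\lambda(\Omega(x)+\Sigma(\xi))}\qquad\text{for all }x,\xi\in\mathbb R^N .$$ -/

import Mathlib

noncomputable section

namespace Beurling

/-- Weight functions. A weight is a function on `[0, ∞)`; here it is a function on `ℝ` of which only
the values on `[0, ∞)` are constrained (and used). -/
structure WeightFunction where
  toFun : ℝ → ℝ
  continuousOn : ContinuousOn toFun (Set.Ici 0)
  monotoneOn : MonotoneOn toFun (Set.Ici 0)
  nonneg : ∀ x, 0 ≤ x → 0 ≤ toFun x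
  /-- condition (α) -/
  doubling : ∃ K : ℝ, 1 ≤ K ∧ ∀ x, 0 ≤ x → toFun (2 * x) ≤ K * (1 + toFun x)
  /-- condition (β) -/
  isLittleO : toFun =o[Filter.atTop] (fun x : ℝ => x)
  /-- condition (γ) -/
  log_le : ∃ a b : ℝ, 0 < b ∧ ∀ x, 0 ≤ x → a + b * Real.log (1 + x) ≤ toFun x
  /-- condition (δ) -/
  convexOn_comp_exp : ConvexOn ℝ Set.univ (fun x : ℝ => toFun (Real.exp x))

variable {N : ℕ}

/-- The function `(ω₁ ⊕ ⋯ ⊕ ω_N)(x) = ω₁(|x₁|) + ⋯ + ω_N(|x_N|)` on `ℝ^N`. -/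
def directSum (ω : Fin N → WeightFunction) (x : EuclideanSpace ℝ (Fin N)) : ℝ :=
  ∑ j, (ω j).toFun |x j|

/-- `D_j = -i ∂_j`. -/
def pderiv (j : Fin N) (f : EuclideanSpace ℝ (Fin N) → ℂ) : EuclideanSpace ℝ (Fin N) → ℂ :=
  fun x => -Complex.I * fderiv ℝ f x (EuclideanSpace.single j 1)

/-- `D^α = D_1^{α_1} ⋯ D_N^{α_N}`. -/
def mderiv (α : Fin N → ℕ) (f : EuclideanSpace ℝ (Fin N) → ℂ) : EuclideanSpace ℝ (Fin N) → ℂ :=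
  (List.finRange N).foldr (fun j h => (pderiv j)^[α j] h) f

/-- The Fourier transform `f̂(ξ) = ∫ exp(-i x·ξ) f(x) dx`. -/
def fourierT (f : EuclideanSpace ℝ (Fin N) → ℂ) (ξ : EuclideanSpace ℝ (Fin N)) : ℂ :=
  ∫ x, Complex.exp (-(Complex.I * (inner ℝ x ξ : ℝ))) * f x

/-- `f ∈ C^∞(ℝ^N)` and `‖exp(lΩ) D^α f‖_∞ < ∞` for all `l > 0` and all multi-indices `α`. -/
def WeightedSmooth (Ω : EuclideanSpace ℝ (Fin N) → ℝ) (f : EuclideanSpace ℝ (Fin N) → ℂ) : Prop :=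
  ContDiff ℝ (⊤ : ℕ∞) f ∧
    ∀ l : ℝ, 0 < l → ∀ α : Fin N → ℕ, ∃ C : ℝ, ∀ x, Real.exp (l * Ω x) * ‖mderiv α f x‖ ≤ C

/-! ### Linearity and smoothness of the operators -/

lemma contDiff_pderiv (j : Fin N) {f : EuclideanSpace ℝ (Fin N) → ℂ} (hf : ContDiff ℝ (⊤ : ℕ∞) f) :
    ContDiff ℝ (⊤ : ℕ∞) (pderiv j f) := by
  have h : ContDiff ℝ (⊤ : ℕ∞) (fderiv ℝ f) := hf.fderiv_right (by simp)
  exact contDiff_const.mul (h.clm_apply contDiff_const)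

lemma pderiv_add (j : Fin N) {f g : EuclideanSpace ℝ (Fin N) → ℂ} (hf : ContDiff ℝ (⊤ : ℕ∞) f)
    (hg : ContDiff ℝ (⊤ : ℕ∞) g) : pderiv j (f + g) = pderiv j f + pderiv j g := by
  funext x
  have h1 := (hf.differentiable (by simp)) x
  have h2 := (hg.differentiable (by simp)) x
  simp only [pderiv, fderiv_add h1 h2, Pi.add_apply, add_apply]
  ring

lemma pderiv_smul (j : Fin N) (c : ℂ) {f : EuclideanSpace ℝ (Fin N) → ℂ} (hf : ContDiff ℝ (⊤ : ℕ∞) f) :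
    pderiv j (c • f) = c • pderiv j f := by
  funext x
  have h1 := (hf.differentiable (by simp)) x
  simp only [pderiv, fderiv_const_smul h1, Pi.smul_apply, smul_apply,
    smul_eq_mul]
  ring

/-- A set of functions stable under all `D_j` is stable under all `D^α`. -/
lemma mderiv_mem {T : Set (EuclideanSpace ℝ (Fin N) → ℂ)}
    (hT : ∀ j, ∀ f ∈ T, pderiv j f ∈ T) (α : Fin N → ℕ) {f : EuclideanSpace ℝ (Fin N) → ℂ}
    (hf : f ∈ T) : mderiv α f ∈ T := by
  have key : ∀ l : List (Fin N), l.foldr (fun j h => (pderiv j)^[α j] h) f ∈ T := by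
    intro l
    induction l with
    | nil => exact hf
    | cons j t ih =>
      have : ∀ n : ℕ, ∀ h ∈ T, (pderiv j)^[n] h ∈ T := by
        intro n
        induction n with
        | zero => intro h hh; exact hh
        | succ n ihn => intro h hh; exact ihn _ (hT j h hh)
      exact this _ _ ih
  exact key _

/-- An identity between smooth functions that is preserved by all `D_j` is preserved by `D^α`. -/
lemma mderiv_rel {R : (EuclideanSpace ℝ (Fin N) → ℂ) → (EuclideanSpace ℝ (Fin N) → ℂ) →
      (EuclideanSpace ℝ (Fin N) → ℂ) → Prop}
    (hR : ∀ j f g h, R f g h → R (pderiv j f) (pderiv j g) (pderiv j h)) (α : Fin N → ℕ)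
    {f g h : EuclideanSpace ℝ (Fin N) → ℂ} (H : R f g h) :
    R (mderiv α f) (mderiv α g) (mderiv α h) := by
  have key : ∀ l : List (Fin N), R (l.foldr (fun j h => (pderiv j)^[α j] h) f)
      (l.foldr (fun j h => (pderiv j)^[α j] h) g) (l.foldr (fun j h => (pderiv j)^[α j] h) h) := by
    intro l
    induction l with
    | nil => exact H
    | cons j t ih =>
      have : ∀ n : ℕ, ∀ f g h, R f g h →
          R ((pderiv j)^[n] f) ((pderiv j)^[n] g) ((pderiv j)^[n] h) := by
        intro n
        induction n with
        | zero => intro f g h hh; exact hh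
        | succ n ihn => intro f g h hh; exact ihn _ _ _ (hR j _ _ _ hh)
      exact this _ _ _ _ ih
  exact key _

lemma mderiv_add (α : Fin N → ℕ) {f g : EuclideanSpace ℝ (Fin N) → ℂ} (hf : ContDiff ℝ (⊤ : ℕ∞) f)
    (hg : ContDiff ℝ (⊤ : ℕ∞) g) : mderiv α (f + g) = mderiv α f + mderiv α g := by
  refine (mderiv_rel (R := fun a b c => ContDiff ℝ (⊤ : ℕ∞) b ∧ ContDiff ℝ (⊤ : ℕ∞) c ∧ a = b + c)
    ?_ α ⟨hf, hg, rfl⟩).2.2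
  rintro j a b c ⟨hb, hc, rfl⟩
  exact ⟨contDiff_pderiv j hb, contDiff_pderiv j hc, pderiv_add j hb hc⟩

lemma mderiv_smul (α : Fin N → ℕ) (c : ℂ) {f : EuclideanSpace ℝ (Fin N) → ℂ}
    (hf : ContDiff ℝ (⊤ : ℕ∞) f) : mderiv α (c • f) = c • mderiv α f := by
  refine (mderiv_rel (R := fun a b _ => ContDiff ℝ (⊤ : ℕ∞) b ∧ a = c • b)
    ?_ α (h := f) ⟨hf, rfl⟩).2
  rintro j a b _ ⟨hb, rfl⟩
  exact ⟨contDiff_pderiv j hb, pderiv_smul j c hb⟩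

lemma integrable_char_mul {f : EuclideanSpace ℝ (Fin N) → ℂ} (hf : MeasureTheory.Integrable f)
    (ξ : EuclideanSpace ℝ (Fin N)) :
    MeasureTheory.Integrable
      (fun x => Complex.exp (-(Complex.I * (inner ℝ x ξ : ℝ))) * f x) := by
  refine hf.bdd_mul (c := 1) (Continuous.aestronglyMeasurable (by fun_prop))
    (Filter.Eventually.of_forall fun x => le_of_eq ?_)
  rw [Complex.norm_exp]
  simp

lemma fourierT_add {f g : EuclideanSpace ℝ (Fin N) → ℂ} (hf : MeasureTheory.Integrable f)
    (hg : MeasureTheory.Integrable g) : fourierT (f + g) = fourierT f + fourierT g := by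
  funext ξ
  simp only [fourierT, Pi.add_apply, mul_add]
  exact MeasureTheory.integral_add (integrable_char_mul hf ξ) (integrable_char_mul hg ξ)

lemma fourierT_smul (c : ℂ) (f : EuclideanSpace ℝ (Fin N) → ℂ) :
    fourierT (c • f) = c • fourierT f := by
  funext ξ
  simp only [fourierT, Pi.smul_apply, smul_eq_mul]
  rw [← MeasureTheory.integral_const_mul]
  congr 1
  funext x
  ring

lemma WeightedSmooth.add {Ω : EuclideanSpace ℝ (Fin N) → ℝ} {f g : EuclideanSpace ℝ (Fin N) → ℂ}
    (hf : WeightedSmooth Ω f) (hg : WeightedSmooth Ω g) : WeightedSmooth Ω (f + g) := by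
  refine ⟨hf.1.add hg.1, fun l hl α => ?_⟩
  obtain ⟨A, hA⟩ := hf.2 l hl α
  obtain ⟨B, hB⟩ := hg.2 l hl α
  refine ⟨A + B, fun x => ?_⟩
  rw [mderiv_add α hf.1 hg.1]
  calc Real.exp (l * Ω x) * ‖mderiv α f x + mderiv α g x‖
      ≤ Real.exp (l * Ω x) * (‖mderiv α f x‖ + ‖mderiv α g x‖) := by
        gcongr; exact norm_add_le _ _
    _ ≤ A + B := by rw [mul_add]; exact add_le_add (hA x) (hB x)

lemma WeightedSmooth.smul {Ω : EuclideanSpace ℝ (Fin N) → ℝ} (c : ℂ)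
    {f : EuclideanSpace ℝ (Fin N) → ℂ}
    (hf : WeightedSmooth Ω f) : WeightedSmooth Ω (c • f) := by
  refine ⟨contDiff_const.smul hf.1, fun l hl α => ?_⟩
  obtain ⟨A, hA⟩ := hf.2 l hl α
  refine ⟨‖c‖ * A, fun x => ?_⟩
  rw [mderiv_smul α c hf.1, Pi.smul_apply, norm_smul, mul_left_comm]
  exact mul_le_mul_of_nonneg_left (hA x) (norm_nonneg c)

lemma WeightedSmooth.zero (Ω : EuclideanSpace ℝ (Fin N) → ℝ) :
    WeightedSmooth Ω (0 : EuclideanSpace ℝ (Fin N) → ℂ) := by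
  refine ⟨contDiff_const, fun l _ α => ⟨0, fun x => ?_⟩⟩
  have h := mderiv_smul α (0 : ℂ) (f := (0 : EuclideanSpace ℝ (Fin N) → ℂ)) contDiff_const
  simp only [zero_smul] at h
  simp [h]

/-! ### The space `S_Ω^Σ(ℝ^N)`, with `Ω = ⊕ ω_j` and `Σ = ⊕ σ_j` -/

/-- The functions `f ∈ L¹(ℝ^N)` such that `f` and `f̂` are smooth and, for all `l > 0` and all
multi-indices `α`, `‖exp(lΩ) D^α f‖_∞ < ∞` and `‖exp(lΣ) D^α f̂‖_∞ < ∞`. -/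
def spaceSubmodule (ω σ : Fin N → WeightFunction) :
    Submodule ℂ (EuclideanSpace ℝ (Fin N) → ℂ) where
  carrier := {f | MeasureTheory.Integrable f ∧ WeightedSmooth (directSum ω) f ∧
    WeightedSmooth (directSum σ) (fourierT f)}
  add_mem' := by
    rintro f g ⟨hf, hf1, hf2⟩ ⟨hg, hg1, hg2⟩
    exact ⟨hf.add hg, hf1.add hg1, by rw [fourierT_add hf hg]; exact hf2.add hg2⟩
  zero_mem' := by
    refine ⟨MeasureTheory.integrable_zero _ _ _, WeightedSmooth.zero _, ?_⟩
    have h := fourierT_smul (0 : ℂ) (0 : EuclideanSpace ℝ (Fin N) → ℂ)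
    simp only [zero_smul] at h
    rw [h]
    exact WeightedSmooth.zero _
  smul_mem' := by
    rintro c f ⟨hf, hf1, hf2⟩
    exact ⟨hf.smul c, hf1.smul c, by rw [fourierT_smul]; exact hf2.smul c⟩

/-- The space `S_Ω^Σ(ℝ^N)` as a type of its own, so that it carries its Fréchet topology and not
the topology of pointwise convergence. -/
def Space (ω σ : Fin N → WeightFunction) : Type := spaceSubmodule ω σ

instance (ω σ : Fin N → WeightFunction) : AddCommGroup (Space ω σ) :=
  inferInstanceAs (AddCommGroup (spaceSubmodule ω σ))

instance (ω σ : Fin N → WeightFunction) : Module ℂ (Space ω σ) :=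
  inferInstanceAs (Module ℂ (spaceSubmodule ω σ))

instance (ω σ : Fin N → WeightFunction) :
    CoeFun (Space ω σ) (fun _ => EuclideanSpace ℝ (Fin N) → ℂ) := ⟨fun f => f.1⟩

lemma bddAbove_of_weightedSmooth {Ω : EuclideanSpace ℝ (Fin N) → ℝ}
    {f : EuclideanSpace ℝ (Fin N) → ℂ}
    (hf : WeightedSmooth Ω f) (n : ℕ) (α : Fin N → ℕ) :
    BddAbove (Set.range fun x => Real.exp (((n : ℝ) + 1) * Ω x) * ‖mderiv α f x‖) := by
  obtain ⟨C, hC⟩ := hf.2 ((n : ℝ) + 1) (by positivity) α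
  exact ⟨C, by rintro _ ⟨x, rfl⟩; exact hC x⟩

/-- `‖exp((n+1)Ω) D^α f‖_∞`. -/
def weightedSup (Ω : EuclideanSpace ℝ (Fin N) → ℝ) (n : ℕ) (α : Fin N → ℕ)
    (f : EuclideanSpace ℝ (Fin N) → ℂ) : ℝ :=
  ⨆ x, Real.exp (((n : ℝ) + 1) * Ω x) * ‖mderiv α f x‖

lemma weightedSup_add {Ω : EuclideanSpace ℝ (Fin N) → ℝ} (n : ℕ) (α : Fin N → ℕ)
    {f g : EuclideanSpace ℝ (Fin N) → ℂ} (hf : WeightedSmooth Ω f) (hg : WeightedSmooth Ω g) :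
    weightedSup Ω n α (f + g) ≤ weightedSup Ω n α f + weightedSup Ω n α g := by
  refine ciSup_le fun x => ?_
  rw [mderiv_add α hf.1 hg.1]
  calc Real.exp (((n : ℝ) + 1) * Ω x) * ‖mderiv α f x + mderiv α g x‖
      ≤ Real.exp (((n : ℝ) + 1) * Ω x) * (‖mderiv α f x‖ + ‖mderiv α g x‖) := by
        gcongr; exact norm_add_le _ _
    _ ≤ _ := by
        rw [mul_add]
        exact add_le_add (le_ciSup (bddAbove_of_weightedSmooth hf n α) x)
          (le_ciSup (bddAbove_of_weightedSmooth hg n α) x)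

lemma weightedSup_smul {Ω : EuclideanSpace ℝ (Fin N) → ℝ} (n : ℕ) (α : Fin N → ℕ) (c : ℂ)
    {f : EuclideanSpace ℝ (Fin N) → ℂ} (hf : WeightedSmooth Ω f) :
    weightedSup Ω n α (c • f) = ‖c‖ * weightedSup Ω n α f := by
  rw [weightedSup, mderiv_smul α c hf.1, weightedSup, Real.mul_iSup_of_nonneg (norm_nonneg c)]
  congr 1
  funext x
  rw [Pi.smul_apply, norm_smul, mul_left_comm]

/-- The seminorm `f ↦ ‖exp((n+1)Ω) D^α f‖_∞`. -/
def seminormLeft (ω σ : Fin N → WeightFunction) (n : ℕ) (α : Fin N → ℕ) :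
    Seminorm ℂ (Space ω σ) :=
  Seminorm.of (fun f => weightedSup (directSum ω) n α f.1)
    (fun f g => weightedSup_add n α f.2.2.1 g.2.2.1)
    (fun c f => weightedSup_smul n α c f.2.2.1)

/-- The seminorm `f ↦ ‖exp((n+1)Σ) D^α f̂‖_∞`. -/
def seminormRight (ω σ : Fin N → WeightFunction) (n : ℕ) (α : Fin N → ℕ) :
    Seminorm ℂ (Space ω σ) :=
  Seminorm.of (fun f => weightedSup (directSum σ) n α (fourierT f.1))
    (fun f g => by
      have h := fourierT_add f.2.1 g.2.1
      change weightedSup (directSum σ) n α (fourierT (f.1 + g.1)) ≤ _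
      rw [h]
      exact weightedSup_add n α f.2.2.2 g.2.2.2)
    (fun c f => by
      change weightedSup (directSum σ) n α (fourierT (c • f.1)) = _
      rw [fourierT_smul]
      exact weightedSup_smul n α c f.2.2.2)

/-- The countable family of seminorms defining the topology of `S_Ω^Σ(ℝ^N)`. -/
def seminorms (ω σ : Fin N → WeightFunction) :
    SeminormFamily ℂ (Space ω σ) ((ℕ × (Fin N → ℕ)) ⊕ (ℕ × (Fin N → ℕ))) :=
  Sum.elim (fun p => seminormLeft ω σ p.1 p.2) (fun p => seminormRight ω σ p.1 p.2)

instance (ω σ : Fin N → WeightFunction) : TopologicalSpace (Space ω σ) :=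
  (seminorms ω σ).moduleFilterBasis.topology

lemma withSeminorms (ω σ : Fin N → WeightFunction) : WithSeminorms (seminorms ω σ) := ⟨rfl⟩

/-- The ultradistributions: continuous linear functionals on `S_Ω^Σ(ℝ^N)`. -/
abbrev Ultradistribution (ω σ : Fin N → WeightFunction) : Type := Space ω σ →L[ℂ] ℂ

/-- An ultradistribution belongs to `S_Ω^Σ(ℝ^N)` if it is `φ ↦ ∫ h(t) φ(t) dt` for some
`h ∈ S_Ω^Σ(ℝ^N)`. -/
def Ultradistribution.BelongsToSpace {ω σ : Fin N → WeightFunction}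
    (f : Ultradistribution ω σ) : Prop :=
  ∃ h : Space ω σ, ∀ φ : Space ω σ, f φ = ∫ t, h t * φ t

/-! ### Time-frequency shifts preserve the space -/

lemma WeightFunction.add_le (w : WeightFunction) : ∃ K : ℝ, 1 ≤ K ∧ ∀ x y : ℝ,
    w.toFun |x + y| ≤ K * (1 + w.toFun |x| + w.toFun |y|) := by
  obtain ⟨K, hK, h⟩ := w.doubling
  refine ⟨K, hK, fun x y => ?_⟩
  have hx := w.nonneg _ (abs_nonneg x)
  have hy := w.nonneg _ (abs_nonneg y)
  have hm : ∀ u v : ℝ, |v| ≤ |u| → w.toFun |u + v| ≤ K * (1 + w.toFun |u|) := fun u v huv =>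
    (w.monotoneOn (Set.mem_Ici.2 (abs_nonneg _)) (by simp) (by linarith [abs_add_le u v])).trans
      (h |u| (abs_nonneg u))
  rcases le_total |y| |x| with hxy | hxy
  · exact (hm x y hxy).trans (mul_le_mul_of_nonneg_left (by linarith) (by linarith))
  · rw [add_comm x y]
    exact (hm y x hxy).trans (mul_le_mul_of_nonneg_left (by linarith) (by linarith))

lemma directSum_nonneg (ω : Fin N → WeightFunction) (x : EuclideanSpace ℝ (Fin N)) :
    0 ≤ directSum ω x :=
  Finset.sum_nonneg fun j _ => (ω j).nonneg _ (abs_nonneg _)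

lemma directSum_neg (ω : Fin N → WeightFunction) (x : EuclideanSpace ℝ (Fin N)) :
    directSum ω (-x) = directSum ω x := by
  simp [directSum]

lemma directSum_add_le (ω : Fin N → WeightFunction) : ∃ K : ℝ, 0 < K ∧
    ∀ x y, directSum ω (x + y) ≤ K * (1 + directSum ω x + directSum ω y) := by
  choose K hK h using fun j => (ω j).add_le
  have hS : 0 ≤ ∑ j, K j := Finset.sum_nonneg fun j _ => zero_le_one.trans (hK j)
  refine ⟨1 + (N + 1) * ∑ j, K j, by positivity, fun x y => ?_⟩
  have hx := directSum_nonneg ω x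
  have hy := directSum_nonneg ω y
  have key : ∀ j ∈ Finset.univ, (ω j).toFun |(x + y) j| ≤
      (∑ i, K i) * (1 + directSum ω x + directSum ω y) := by
    intro j _
    have h1 : (ω j).toFun |x j| ≤ directSum ω x :=
      Finset.single_le_sum (f := fun j => (ω j).toFun |x j|)
        (fun i _ => (ω i).nonneg _ (abs_nonneg _)) (Finset.mem_univ j)
    have h2 : (ω j).toFun |y j| ≤ directSum ω y :=
      Finset.single_le_sum (f := fun j => (ω j).toFun |y j|)
        (fun i _ => (ω i).nonneg _ (abs_nonneg _)) (Finset.mem_univ j)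
    have h3 : K j ≤ ∑ i, K i :=
      Finset.single_le_sum (fun i _ => zero_le_one.trans (hK i)) (Finset.mem_univ j)
    have h4 := (ω j).nonneg _ (abs_nonneg (x j))
    have h5 := (ω j).nonneg _ (abs_nonneg (y j))
    calc (ω j).toFun |(x + y) j| ≤ K j * (1 + (ω j).toFun |x j| + (ω j).toFun |y j|) :=
          h j (x j) (y j)
      _ ≤ _ := by gcongr
  have := Finset.sum_le_sum key
  rw [Finset.sum_const, Finset.card_univ, Fintype.card_fin, nsmul_eq_mul] at this
  refine this.trans ?_
  nlinarith [mul_nonneg hS (show 0 ≤ 1 + directSum ω x + directSum ω y by positivity)]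

lemma pderiv_comm (i j : Fin N) {f : EuclideanSpace ℝ (Fin N) → ℂ} (hf : ContDiff ℝ (⊤ : ℕ∞) f) :
    pderiv i (pderiv j f) = pderiv j (pderiv i f) := by
  have h1 : ContDiff ℝ (⊤ : ℕ∞) (fderiv ℝ f) := hf.fderiv_right (by simp)
  have h2 : ∀ x, DifferentiableAt ℝ (fderiv ℝ f) x := h1.differentiable (by simp)
  have hsymm : ∀ x, IsSymmSndFDerivAt ℝ f x := fun x =>
    (hf.contDiffAt).isSymmSndFDerivAt (by
      rw [minSmoothness_of_isRCLikeNormedField]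
      exact WithTop.coe_le_coe.2 (le_top : (2 : ℕ∞) ≤ ⊤))
  have key : ∀ (k l : Fin N) (x : EuclideanSpace ℝ (Fin N)), pderiv k (pderiv l f) x =
      -Complex.I * (-Complex.I * fderiv ℝ (fderiv ℝ f) x (EuclideanSpace.single k 1)
        (EuclideanSpace.single l 1)) := by
    intro k l x
    have hd : DifferentiableAt ℝ (fun y => fderiv ℝ f y (EuclideanSpace.single l 1)) x :=
      (h2 x).clm_apply (differentiableAt_const _)
    have h3 : fderiv ℝ (pderiv l f) x = _ := fderiv_const_mul hd (-Complex.I)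
    rw [pderiv, h3, fderiv_clm_apply (h2 x) (differentiableAt_const _)]
    simp
  funext x
  rw [key, key, (hsymm x).eq]

lemma mderiv_pderiv (α : Fin N → ℕ) (i : Fin N) {f : EuclideanSpace ℝ (Fin N) → ℂ}
    (hf : ContDiff ℝ (⊤ : ℕ∞) f) : mderiv α (pderiv i f) = mderiv (α + Pi.single i 1) f := by
  have it : ∀ (j : Fin N) (n : ℕ) (h : EuclideanSpace ℝ (Fin N) → ℂ), ContDiff ℝ (⊤ : ℕ∞) h →
      ContDiff ℝ (⊤ : ℕ∞) ((pderiv j)^[n] h) ∧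
        (pderiv j)^[n] (pderiv i h) = pderiv i ((pderiv j)^[n] h) := by
    intro j n
    induction n with
    | zero => intro h hh; exact ⟨hh, rfl⟩
    | succ n ih =>
      intro h hh
      rw [Function.iterate_succ_apply, Function.iterate_succ_apply, pderiv_comm j i hh]
      exact ih _ (contDiff_pderiv j hh)
  have fo : ∀ l : List (Fin N), ContDiff ℝ (⊤ : ℕ∞) (l.foldr (fun j h => (pderiv j)^[α j] h) f) ∧
      l.foldr (fun j h => (pderiv j)^[α j] h) (pderiv i f) =
        pderiv i (l.foldr (fun j h => (pderiv j)^[α j] h) f) := by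
    intro l
    induction l with
    | nil => exact ⟨hf, rfl⟩
    | cons j t ih =>
      refine ⟨(it j _ _ ih.1).1, ?_⟩
      rw [List.foldr_cons, ih.2, (it j _ _ ih.1).2, List.foldr_cons]
  have no : ∀ l : List (Fin N), i ∉ l → l.foldr (fun j h => (pderiv j)^[α j] h) f =
      l.foldr (fun j h => (pderiv j)^[(α + Pi.single i 1 : Fin N → ℕ) j] h) f := by
    intro l
    induction l with
    | nil => intro _; rfl
    | cons j t ih =>
      intro hi
      rw [List.mem_cons, not_or] at hi
      rw [List.foldr_cons, List.foldr_cons, ih hi.2]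
      simp [Pi.single_eq_of_ne (Ne.symm hi.1)]
  have main : ∀ l : List (Fin N), l.Nodup → i ∈ l →
      l.foldr (fun j h => (pderiv j)^[α j] h) (pderiv i f) =
      l.foldr (fun j h => (pderiv j)^[(α + Pi.single i 1 : Fin N → ℕ) j] h) f := by
    intro l
    induction l with
    | nil => intro _ h; simp at h
    | cons j t ih =>
      intro hn hi
      rw [List.nodup_cons] at hn
      rw [List.foldr_cons, List.foldr_cons]
      by_cases hij : j = i
      · subst hij
        rw [(fo t).2, no t hn.1, Pi.add_apply, Pi.single_eq_same, Function.iterate_succ_apply]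
      · have hit : i ∈ t := by
          rcases List.mem_cons.1 hi with h | h
          · exact absurd h.symm hij
          · exact h
        rw [ih hn.2 hit]
        simp [Pi.single_eq_of_ne hij]
  exact main _ (List.nodup_finRange N) (List.mem_finRange i)

lemma WeightedSmooth.pderiv {Ω : EuclideanSpace ℝ (Fin N) → ℝ}
    {f : EuclideanSpace ℝ (Fin N) → ℂ} (hf : WeightedSmooth Ω f) (j : Fin N) :
    WeightedSmooth Ω (pderiv j f) :=
  ⟨contDiff_pderiv j hf.1, fun l hl α => by
    rw [mderiv_pderiv α j hf.1]; exact hf.2 l hl _⟩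

lemma mderiv_zero (f : EuclideanSpace ℝ (Fin N) → ℂ) : mderiv 0 f = f := by
  have : ∀ l : List (Fin N),
      l.foldr (fun j h => (Beurling.pderiv j)^[(0 : Fin N → ℕ) j] h) f = f := by
    intro l
    induction l with
    | nil => rfl
    | cons j t ih => rw [List.foldr_cons, ih]; rfl
  exact this _

/-- A set of smooth functions, stable under all `D_j`, whose elements decay faster than every
`exp(-lΩ)`, consists of elements of `WeightedSmooth Ω`. -/
lemma weightedSmooth_of_stable {Ω : EuclideanSpace ℝ (Fin N) → ℝ}
    {T : Set (EuclideanSpace ℝ (Fin N) → ℂ)} (h1 : ∀ f ∈ T, ContDiff ℝ (⊤ : ℕ∞) f)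
    (h2 : ∀ f ∈ T, ∀ l : ℝ, 0 < l → ∃ C : ℝ, ∀ x, Real.exp (l * Ω x) * ‖f x‖ ≤ C)
    (h3 : ∀ j, ∀ f ∈ T, Beurling.pderiv j f ∈ T) {f : EuclideanSpace ℝ (Fin N) → ℂ}
    (hf : f ∈ T) : WeightedSmooth Ω f :=
  ⟨h1 f hf, fun l hl α => h2 _ (mderiv_mem h3 α hf) l hl⟩

lemma WeightedSmooth.bound {Ω : EuclideanSpace ℝ (Fin N) → ℝ}
    {f : EuclideanSpace ℝ (Fin N) → ℂ} (hf : WeightedSmooth Ω f) (l : ℝ) (hl : 0 < l) :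
    ∃ C : ℝ, ∀ x, Real.exp (l * Ω x) * ‖f x‖ ≤ C := by
  simpa only [mderiv_zero] using hf.2 l hl 0

lemma WeightedSmooth.translate {ω : Fin N → WeightFunction} {f : EuclideanSpace ℝ (Fin N) → ℂ}
    (hf : WeightedSmooth (directSum ω) f) (x : EuclideanSpace ℝ (Fin N)) :
    WeightedSmooth (directSum ω) (fun t => f (t - x)) := by
  refine weightedSmooth_of_stable
    (T := {k | ∃ h, WeightedSmooth (directSum ω) h ∧ k = fun t => h (t - x)}) ?_ ?_ ?_ ⟨f, hf, rfl⟩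
  · rintro _ ⟨h, hh, rfl⟩
    exact hh.1.comp (contDiff_id.sub contDiff_const)
  · rintro _ ⟨h, hh, rfl⟩ l hl
    obtain ⟨K, hK, hadd⟩ := directSum_add_le ω
    obtain ⟨C, hC⟩ := hh.bound (l * K) (by positivity)
    refine ⟨Real.exp (l * K * (1 + directSum ω x)) * C, fun t => ?_⟩
    have h1 := hadd (t - x) x
    rw [sub_add_cancel] at h1
    have h2 : l * directSum ω t ≤ l * K * (1 + directSum ω x) + l * K * directSum ω (t - x) := by
      nlinarith
    calc Real.exp (l * directSum ω t) * ‖h (t - x)‖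
        ≤ Real.exp (l * K * (1 + directSum ω x) + l * K * directSum ω (t - x)) * ‖h (t - x)‖ := by
          gcongr
      _ = Real.exp (l * K * (1 + directSum ω x)) *
            (Real.exp (l * K * directSum ω (t - x)) * ‖h (t - x)‖) := by
          rw [Real.exp_add, mul_assoc]
      _ ≤ _ := by gcongr; exact hC _
  · rintro j _ ⟨h, hh, rfl⟩
    refine ⟨_, hh.pderiv j, ?_⟩
    funext t
    simp only [Beurling.pderiv, fderiv_comp_sub]

lemma WeightedSmooth.conj {Ω : EuclideanSpace ℝ (Fin N) → ℝ} {f : EuclideanSpace ℝ (Fin N) → ℂ}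
    (hf : WeightedSmooth Ω f) : WeightedSmooth Ω (fun t => (starRingEnd ℂ) (f t)) := by
  refine weightedSmooth_of_stable
    (T := {k | ∃ h, WeightedSmooth Ω h ∧ k = fun t => (starRingEnd ℂ) (h t)}) ?_ ?_ ?_ ⟨f, hf, rfl⟩
  · rintro _ ⟨h, hh, rfl⟩
    exact Complex.conjCLE.contDiff.comp hh.1
  · rintro _ ⟨h, hh, rfl⟩ l hl
    simpa using hh.bound l hl
  · rintro j _ ⟨h, hh, rfl⟩
    refine ⟨_, (hh.pderiv j).smul (-1), ?_⟩
    funext t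
    have hd := (hh.1.differentiable (by simp)) t
    have h1 : fderiv ℝ (fun t => (starRingEnd ℂ) (h t)) t =
        (Complex.conjCLE : ℂ →L[ℝ] ℂ).comp (fderiv ℝ h t) :=
      ((Complex.conjCLE : ℂ →L[ℝ] ℂ).hasFDerivAt.comp t hd.hasFDerivAt).fderiv
    simp [Beurling.pderiv, h1]

lemma WeightedSmooth.reflect {ω : Fin N → WeightFunction} {f : EuclideanSpace ℝ (Fin N) → ℂ}
    (hf : WeightedSmooth (directSum ω) f) : WeightedSmooth (directSum ω) (fun t => f (-t)) := by
  refine weightedSmooth_of_stable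
    (T := {k | ∃ h, WeightedSmooth (directSum ω) h ∧ k = fun t => h (-t)}) ?_ ?_ ?_ ⟨f, hf, rfl⟩
  · rintro _ ⟨h, hh, rfl⟩
    exact hh.1.comp contDiff_neg
  · rintro _ ⟨h, hh, rfl⟩ l hl
    obtain ⟨C, hC⟩ := hh.bound l hl
    exact ⟨C, fun t => by simpa only [directSum_neg] using hC (-t)⟩
  · rintro j _ ⟨h, hh, rfl⟩
    refine ⟨_, (hh.pderiv j).smul (-1), ?_⟩
    funext t
    have hd := (hh.1.differentiable (by simp)) (-t)
    have h1 : fderiv ℝ (fun t => h (-t)) t =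
        (fderiv ℝ h (-t)).comp (-ContinuousLinearMap.id ℝ (EuclideanSpace ℝ (Fin N))) :=
      (hd.hasFDerivAt.comp t (hasFDerivAt_id t).neg).fderiv
    simp [Beurling.pderiv, h1]

lemma WeightedSmooth.modulate {Ω : EuclideanSpace ℝ (Fin N) → ℝ}
    {f : EuclideanSpace ℝ (Fin N) → ℂ} (hf : WeightedSmooth Ω f) (ξ : EuclideanSpace ℝ (Fin N)) :
    WeightedSmooth Ω (fun t => Complex.exp (-(Complex.I * (inner ℝ t ξ : ℝ))) * f t) := by
  have hphase : ∀ t, HasFDerivAt (fun t : EuclideanSpace ℝ (Fin N) =>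
      Complex.exp (-(Complex.I * (inner ℝ t ξ : ℝ))))
      (Complex.exp (-(Complex.I * (inner ℝ t ξ : ℝ))) •
        (-(Complex.I • (Complex.ofRealCLM.comp (innerSL ℝ ξ))))) t := by
    intro t
    have h0 : HasFDerivAt (fun t : EuclideanSpace ℝ (Fin N) => ((inner ℝ t ξ : ℝ) : ℂ))
        (Complex.ofRealCLM.comp (innerSL ℝ ξ)) t := by
      have := (Complex.ofRealCLM.comp (innerSL ℝ ξ)).hasFDerivAt (x := t)
      refine this.congr_of_eventuallyEq (Filter.Eventually.of_forall fun s => ?_)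
      simp [real_inner_comm]
    exact ((h0.const_mul Complex.I).neg).cexp
  have hcd : ContDiff ℝ (⊤ : ℕ∞) (fun t : EuclideanSpace ℝ (Fin N) =>
      Complex.exp (-(Complex.I * (inner ℝ t ξ : ℝ)))) :=
    ((contDiff_const.mul
      (Complex.ofRealCLM.contDiff.comp (contDiff_id.inner ℝ contDiff_const))).neg).cexp
  refine weightedSmooth_of_stable
    (T := {k | ∃ h, WeightedSmooth Ω h ∧
      k = fun t => Complex.exp (-(Complex.I * (inner ℝ t ξ : ℝ))) * h t}) ?_ ?_ ?_ ⟨f, hf, rfl⟩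
  · rintro _ ⟨h, hh, rfl⟩
    exact hcd.mul hh.1
  · rintro _ ⟨h, hh, rfl⟩ l hl
    obtain ⟨C, hC⟩ := hh.bound l hl
    refine ⟨C, fun t => ?_⟩
    have : ‖Complex.exp (-(Complex.I * (inner ℝ t ξ : ℝ)))‖ = 1 := by
      rw [Complex.norm_exp]; simp
    rw [norm_mul, this, one_mul]
    exact hC t
  · rintro j _ ⟨h, hh, rfl⟩
    refine ⟨_, (hh.pderiv j).add (hh.smul (-(ξ j : ℂ))), ?_⟩
    funext t
    have hd := (hh.1.differentiable (by simp)) t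
    have h1 := ((hphase t).mul hd.hasFDerivAt).fderiv
    have hin : inner ℝ ξ (EuclideanSpace.single j (1 : ℝ)) = ξ j := by
      simp [EuclideanSpace.inner_single_right]
    rw [Beurling.pderiv, show fderiv ℝ (fun t => Complex.exp (-(Complex.I * (inner ℝ t ξ : ℝ))) * h t) t = _ from h1]
    simp only [add_apply, smul_apply,
      neg_apply, ContinuousLinearMap.comp_apply, innerSL_apply_apply, hin,
      Complex.ofRealCLM_apply, smul_eq_mul, Pi.add_apply, Pi.smul_apply, Beurling.pderiv]
    linear_combination (Complex.exp (-(Complex.I * (inner ℝ t ξ : ℝ))) * h t * (ξ j : ℂ)) *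
      Complex.I_mul_I

lemma fourierT_translate (f : EuclideanSpace ℝ (Fin N) → ℂ) (x : EuclideanSpace ℝ (Fin N)) :
    fourierT (fun t => f (t - x)) =
      fun η => Complex.exp (-(Complex.I * (inner ℝ η x : ℝ))) * fourierT f η := by
  funext η
  simp only [fourierT]
  rw [← MeasureTheory.integral_const_mul, ← MeasureTheory.integral_add_right_eq_self _ x]
  congr 1
  funext t
  rw [add_sub_cancel_right, ← mul_assoc, ← Complex.exp_add, inner_add_left,
    real_inner_comm x η]
  congr 2
  push_cast
  ring

lemma fourierT_modulate (f : EuclideanSpace ℝ (Fin N) → ℂ) (ξ : EuclideanSpace ℝ (Fin N)) :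
    fourierT (fun t => Complex.exp (-(Complex.I * (inner ℝ t ξ : ℝ))) * f t) =
      fun η => fourierT f (η - -ξ) := by
  funext η
  simp only [fourierT]
  congr 1
  funext t
  rw [← mul_assoc, ← Complex.exp_add, sub_neg_eq_add, inner_add_right]
  congr 2
  push_cast
  ring

lemma fourierT_conj (f : EuclideanSpace ℝ (Fin N) → ℂ) :
    fourierT (fun t => (starRingEnd ℂ) (f t)) =
      fun η => (starRingEnd ℂ) (fourierT f (-η)) := by
  funext η
  simp only [fourierT]
  rw [← integral_conj]
  congr 1
  funext t
  rw [map_mul, ← Complex.exp_conj]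
  congr 2
  simp

/-- `t ↦ exp(-i t·ξ) conj(g(t - x))`, as an element of `S_Ω^Σ(ℝ^N)` for `g ∈ S_Ω^Σ(ℝ^N)`. -/
def conjShift {ω σ : Fin N → WeightFunction} (g : Space ω σ) (x ξ : EuclideanSpace ℝ (Fin N)) :
    Space ω σ :=
  ⟨fun t => Complex.exp (-(Complex.I * (inner ℝ t ξ : ℝ))) * (starRingEnd ℂ) (g (t - x)), by
    obtain ⟨g, hg, hg1, hg2⟩ := g
    refine ⟨?_, (hg1.translate x).conj.modulate ξ, ?_⟩
    · have h := Complex.conjCLE.toContinuousLinearMap.integrable_comp (hg.comp_sub_right x)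
      exact integrable_char_mul h ξ
    · change WeightedSmooth (directSum σ) (fourierT (fun t =>
        Complex.exp (-(Complex.I * (inner ℝ t ξ : ℝ))) *
          (fun s => (starRingEnd ℂ) ((fun r => g (r - x)) s)) t))
      rw [fourierT_modulate, fourierT_conj, fourierT_translate]
      exact ((hg2.modulate x).reflect.conj).translate (-ξ)⟩

/-- The short-time Fourier transform `V_g f(x, ξ) = ⟨f, exp(-i t·ξ) conj(g(t - x))⟩` of an
ultradistribution `f`; it is `∫ exp(-i t·ξ) f(t) conj(g(t - x)) dt` if `f` is a function. -/
def stft {ω σ : Fin N → WeightFunction} (g : Space ω σ) (f : Ultradistribution ω σ)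
    (x ξ : EuclideanSpace ℝ (Fin N)) : ℂ :=
  f (conjShift g x ξ)

end Beurling

end

/-!
Put `k = (2π)^N ‖g‖²`. Every `φ ∈ S_Ω^Σ` is a superposition of time-frequency shifts,
`k φ(t) = ∬ ⟨φ, exp(i s·ξ) g(s - x)⟩_s exp(-i t·ξ) conj(g(t - x)) dx dξ`,
by Fourier inversion in `ξ`. The coefficients decay faster than `exp(-l(Ω(x) + Σ(ξ)))` for every
`l`: moving the absolute value inside the pairing gives a convolution of `|φ|` with `|g|`, which
decays in `x`, and Parseval's identity gives one of `|φ̂|` with `|ĝ|`, which decays in `ξ`. This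
estimate for an arbitrary `f ∈ S_Ω^Σ` in place of `φ` is the direct implication.

A derivative of a shift of `g`, or of its Fourier transform, grows at most like an exponential of
the weights, so integrals of shifts against rapidly decaying coefficients stay in `S_Ω^Σ`. By
continuity `f ∈ (S_Ω^Σ)'` is controlled by finitely many seminorms; by Hahn–Banach it is therefore
the restriction of a functional on a finite product of spaces of bounded continuous functions,
where it commutes with Bochner integrals. Applying `f` to the inversion formula yields
`k ⟨f, φ⟩ = ∬ V_g f(x, ξ) ⟨φ, exp(i s·ξ) g(s - x)⟩_s dx dξ`, so if `V_g f` decays rapidly then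
`k f` is the function `∬ V_g f(x, ξ) exp(i t·ξ) g(t - x) dx dξ`, an element of `S_Ω^Σ`.
-/

noncomputable section

namespace Beurling

open MeasureTheory
open scoped Topology BoundedContinuousFunction FourierTransform

/-- The properties of the weights `Ω = ω₁ ⊕ ⋯ ⊕ ω_N` on which the estimates rest, on an arbitrary
normed group: conditions (α) and (γ) enter as `add_le` and `one_add_norm_le`. -/
structure IsAdmissible {V : Type*} [NormedAddCommGroup V] (Ω : V → ℝ) : Prop where
  continuous : Continuous Ω
  nonneg : ∀ x, 0 ≤ Ω x
  neg : ∀ x, Ω (-x) = Ω x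
  add_le : ∃ K, 0 < K ∧ ∀ x y, Ω (x + y) ≤ K * (1 + Ω x + Ω y)
  one_add_norm_le : ∃ C k, 0 < k ∧ ∀ x, 1 + ‖x‖ ≤ C * Real.exp (k * Ω x)

lemma WeightFunction.one_add_le_exp (w : WeightFunction) :
    ∃ C k, 0 < C ∧ 0 < k ∧ ∀ x, 0 ≤ x → 1 + x ≤ C * Real.exp (k * w.toFun x) := by
  obtain ⟨a, b, hb, h⟩ := w.log_le
  refine ⟨Real.exp (-(b⁻¹ * a)), b⁻¹, Real.exp_pos _, inv_pos.2 hb, fun x hx => ?_⟩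
  rw [← Real.exp_add, ← Real.log_le_iff_le_exp (by linarith)]
  calc Real.log (1 + x) = b⁻¹ * (a + b * Real.log (1 + x)) - b⁻¹ * a := by field_simp; ring
    _ ≤ b⁻¹ * w.toFun x - b⁻¹ * a := by have := h x hx; gcongr
    _ = -(b⁻¹ * a) + b⁻¹ * w.toFun x := by ring

section DirectSum

variable {N : ℕ} (ω : Fin N → WeightFunction)

lemma continuous_directSum : Continuous (directSum ω) :=
  continuous_finsetSum Finset.univ fun j _ =>
    (ω j).continuousOn.comp_continuous (by fun_prop) fun x => abs_nonneg (x j)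

lemma one_add_norm_le_exp_directSum :
    ∃ C k, 0 < k ∧ ∀ x, 1 + ‖x‖ ≤ C * Real.exp (k * directSum ω x) := by
  choose C k hC hk h using fun j => (ω j).one_add_le_exp
  have hk₀ : 0 ≤ ∑ j, k j := Finset.sum_nonneg fun j _ => (hk j).le
  refine ⟨1 + ∑ j, C j, 1 + ∑ j, k j, by positivity, fun x => ?_⟩
  have hω (j : Fin N) : 0 ≤ (ω j).toFun |x j| := (ω j).nonneg _ (abs_nonneg _)
  have norm_le : ‖x‖ ≤ ∑ j, |x j| := by
    rw [EuclideanSpace.norm_eq]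
    refine Real.sqrt_le_iff.2 ⟨Finset.sum_nonneg fun j _ => abs_nonneg _, ?_⟩
    simpa only [Real.norm_eq_abs] using
      Finset.sum_sq_le_sq_sum_of_nonneg fun j _ => abs_nonneg (x j)
  have abs_le (j : Fin N) : |x j| ≤ C j * Real.exp ((1 + ∑ j, k j) * directSum ω x) := by
    have hkj : k j ≤ 1 + ∑ j, k j :=
      (Finset.single_le_sum (fun i _ => (hk i).le) (Finset.mem_univ j)).trans
        (le_add_of_nonneg_left zero_le_one)
    have hωj : (ω j).toFun |x j| ≤ directSum ω x :=
      Finset.single_le_sum (fun i _ => hω i) (Finset.mem_univ j)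
    calc |x j| ≤ 1 + |x j| := le_add_of_nonneg_left zero_le_one
      _ ≤ C j * Real.exp (k j * (ω j).toFun |x j|) := h j _ (abs_nonneg _)
      _ ≤ C j * Real.exp ((1 + ∑ j, k j) * directSum ω x) := by
        have := (hC j).le
        have := hω j
        gcongr
  rw [add_mul, one_mul, Finset.sum_mul]
  refine add_le_add (Real.one_le_exp ?_) (norm_le.trans (Finset.sum_le_sum fun j _ => abs_le j))
  exact mul_nonneg (by positivity) (directSum_nonneg ω x)

lemma isAdmissible_directSum : IsAdmissible (directSum ω) where
  continuous := continuous_directSum ω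
  nonneg := directSum_nonneg ω
  neg := directSum_neg ω
  add_le := directSum_add_le ω
  one_add_norm_le := one_add_norm_le_exp_directSum ω

end DirectSum

section Admissible

variable {V W : Type*} [NormedAddCommGroup V] [NormedAddCommGroup W] {Ω : V → ℝ} {Λ : W → ℝ}

lemma IsAdmissible.prod (hΩ : IsAdmissible Ω) (hΛ : IsAdmissible Λ) :
    IsAdmissible fun p : V × W => Ω p.1 + Λ p.2 where
  continuous := (hΩ.continuous.comp continuous_fst).add (hΛ.continuous.comp continuous_snd)
  nonneg p := add_nonneg (hΩ.nonneg _) (hΛ.nonneg _)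
  neg p := congrArg₂ _ (hΩ.neg _) (hΛ.neg _)
  add_le := by
    obtain ⟨K, hK, hadd⟩ := hΩ.add_le
    obtain ⟨L, hL, hadd'⟩ := hΛ.add_le
    refine ⟨K + L, by positivity, fun p q => ?_⟩
    have hp := mul_nonneg hL.le (add_nonneg (hΩ.nonneg p.1) (hΩ.nonneg q.1))
    have hq := mul_nonneg hK.le (add_nonneg (hΛ.nonneg p.2) (hΛ.nonneg q.2))
    rw [Prod.fst_add, Prod.snd_add]
    linarith [hadd p.1 q.1, hadd' p.2 q.2]
  one_add_norm_le := by
    obtain ⟨C, k, hk, h⟩ := hΩ.one_add_norm_le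
    obtain ⟨D, l, hl, h'⟩ := hΛ.one_add_norm_le
    refine ⟨C * D, k + l, by positivity, fun p => ?_⟩
    have hexp : k * Ω p.1 + l * Λ p.2 ≤ (k + l) * (Ω p.1 + Λ p.2) := by
      linarith [mul_nonneg hl.le (hΩ.nonneg p.1), mul_nonneg hk.le (hΛ.nonneg p.2)]
    have h_pos : 0 < C * Real.exp (k * Ω p.1) := lt_of_lt_of_le (by positivity) (h p.1)
    have hC : 0 < C := pos_of_mul_pos_left h_pos (Real.exp_pos _).le
    have h_pos' : 0 < D * Real.exp (l * Λ p.2) := lt_of_lt_of_le (by positivity) (h' p.2)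
    have hD : 0 < D := pos_of_mul_pos_left h_pos' (Real.exp_pos _).le
    have norm_le : ‖p‖ ≤ ‖p.1‖ + ‖p.2‖ := by
      rw [Prod.norm_def]
      exact max_le_add_of_nonneg (norm_nonneg _) (norm_nonneg _)
    calc 1 + ‖p‖ ≤ (1 + ‖p.1‖) * (1 + ‖p.2‖) := by
          linarith [mul_nonneg (norm_nonneg p.1) (norm_nonneg p.2)]
      _ ≤ (C * Real.exp (k * Ω p.1)) * (D * Real.exp (l * Λ p.2)) :=
          mul_le_mul (h _) (h' _) (by positivity) h_pos.le
      _ = C * D * Real.exp (k * Ω p.1 + l * Λ p.2) := by rw [Real.exp_add]; ring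
      _ ≤ C * D * Real.exp ((k + l) * (Ω p.1 + Λ p.2)) := by gcongr

variable [NormedSpace ℝ V] [FiniteDimensional ℝ V] [MeasurableSpace V] [BorelSpace V]

lemma IsAdmissible.exists_integrable_exp_neg (hΩ : IsAdmissible Ω) (μ : Measure V)
    [μ.IsAddHaarMeasure] : ∃ M, 0 < M ∧ Integrable (fun x => Real.exp (-(M * Ω x))) μ := by
  obtain ⟨C, k, hk, h⟩ := hΩ.one_add_norm_le
  set r : ℕ := Module.finrank ℝ V + 1
  have hr : Integrable (fun x : V => C ^ r * (1 + ‖x‖) ^ (-(r : ℝ))) μ :=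
    (integrable_one_add_norm (by simp [r])).const_mul _
  refine ⟨k * r, by positivity, hr.mono' ?_ (.of_forall fun x => ?_)⟩
  · have := hΩ.continuous
    exact Continuous.aestronglyMeasurable (by fun_prop)
  have hx : 0 < 1 + ‖x‖ := by positivity
  have exp_neg_le : Real.exp (-(k * Ω x)) ≤ C * (1 + ‖x‖)⁻¹ := by
    rw [Real.exp_neg, ← div_eq_mul_inv, le_div_iff₀ hx, inv_mul_le_iff₀ (Real.exp_pos _), mul_comm]
    exact h x
  calc ‖Real.exp (-(k * r * Ω x))‖ = Real.exp (-(k * Ω x)) ^ r := by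
        rw [Real.norm_of_nonneg (Real.exp_pos _).le, ← Real.exp_nat_mul]; ring_nf
    _ ≤ (C * (1 + ‖x‖)⁻¹) ^ r := by gcongr
    _ = C ^ r * (1 + ‖x‖) ^ (-(r : ℝ)) := by
        rw [mul_pow, Real.rpow_neg hx.le, Real.rpow_natCast, inv_pow]

end Admissible

/-- `‖b p‖ = O(exp (-l W p))` for every `l > 0`. -/
def RapidDecay {X Y : Type*} [Norm Y] (W : X → ℝ) (b : X → Y) : Prop :=
  ∀ l : ℝ, 0 < l → ∃ C : ℝ, ∀ p, Real.exp (l * W p) * ‖b p‖ ≤ C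

/-- Integrability of `b` against all exponentials of the weight `W`. -/
def ExpIntegrable {X Y : Type*} [MeasurableSpace X] [NormedAddCommGroup Y] [NormedSpace ℝ Y]
    (W : X → ℝ) (b : X → Y) (μ : Measure X) : Prop :=
  ∀ m : ℝ, Integrable (fun p => Real.exp (m * W p) • b p) μ

lemma ExpIntegrable.integrable {X Y : Type*} [MeasurableSpace X] [NormedAddCommGroup Y]
    [NormedSpace ℝ Y] {W : X → ℝ} {b : X → Y} {μ : Measure X} (hb : ExpIntegrable W b μ) :
    Integrable b μ := by
  simpa using hb 0

section RapidDecay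

variable {X Y : Type*} [SeminormedAddGroup Y] {W : X → ℝ} {b : X → Y}

lemma rapidDecay_iff : RapidDecay W b ↔
    ∀ l : ℝ, 0 < l → ∃ C : ℝ, 0 < C ∧ ∀ p, ‖b p‖ ≤ C * Real.exp (-l * W p) := by
  have exp_mul_le_iff (l C : ℝ) (p : X) :
      Real.exp (l * W p) * ‖b p‖ ≤ C ↔ ‖b p‖ ≤ C * Real.exp (-l * W p) := by
    rw [neg_mul, Real.exp_neg, ← div_eq_mul_inv, le_div_iff₀ (Real.exp_pos _), mul_comm]
  simp only [RapidDecay, exp_mul_le_iff]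
  refine forall₂_congr fun l _ => ⟨?_, fun ⟨C, _, h⟩ => ⟨C, h⟩⟩
  rintro ⟨C, h⟩
  refine ⟨max C 1, by positivity, fun p => (h p).trans ?_⟩
  gcongr
  exact le_max_left C 1

lemma RapidDecay.comp_norm_le {Z : Type*} [SeminormedAddGroup Z] {b' : X → Z}
    (hb : RapidDecay W b) (h : ∀ p, ‖b' p‖ ≤ ‖b p‖) : RapidDecay W b' := fun l hl =>
  (hb l hl).imp fun _ hC p => (mul_le_mul_of_nonneg_left (h p) (Real.exp_pos _).le).trans (hC p)

lemma RapidDecay.prod {X' Z : Type*} [SeminormedAddGroup Z] {W' : X' → ℝ} {F : X → Y} {G : X' → Y}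
    {B : X × X' → Z} (hF : RapidDecay W F) (hG : RapidDecay W' G)
    (hBF : ∀ p, ‖B p‖ ≤ ‖F p.1‖) (hBG : ∀ p, ‖B p‖ ≤ ‖G p.2‖) :
    RapidDecay (fun p => W p.1 + W' p.2) B := by
  intro l hl
  obtain ⟨C, hC⟩ := hF (2 * l) (by positivity)
  obtain ⟨D, hD⟩ := hG (2 * l) (by positivity)
  refine ⟨C + D, fun p => ?_⟩
  have exp_le : Real.exp (l * (W p.1 + W' p.2)) ≤
      Real.exp (2 * l * W p.1) + Real.exp (2 * l * W' p.2) := by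
    rcases le_total (W p.1) (W' p.2) with h | h
    · refine le_add_of_nonneg_of_le (Real.exp_pos _).le (Real.exp_le_exp.2 ?_)
      linarith [mul_le_mul_of_nonneg_left h hl.le]
    · refine le_add_of_le_of_nonneg (Real.exp_le_exp.2 ?_) (Real.exp_pos _).le
      linarith [mul_le_mul_of_nonneg_left h hl.le]
  calc Real.exp (l * (W p.1 + W' p.2)) * ‖B p‖ ≤
        Real.exp (2 * l * W p.1) * ‖B p‖ + Real.exp (2 * l * W' p.2) * ‖B p‖ := by
        rw [← add_mul]; gcongr
    _ ≤ Real.exp (2 * l * W p.1) * ‖F p.1‖ + Real.exp (2 * l * W' p.2) * ‖G p.2‖ := by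
        gcongr
        exacts [hBF p, hBG p]
    _ ≤ C + D := add_le_add (hC _) (hD _)

end RapidDecay

section Integrable

variable {V Y Z : Type*} [NormedAddCommGroup V] [NormedSpace ℝ V] [FiniteDimensional ℝ V]
  [MeasurableSpace V] [BorelSpace V] {Ω : V → ℝ} {μ : Measure V} [μ.IsAddHaarMeasure]
  [NormedAddCommGroup Y] [NormedAddCommGroup Z]

lemma RapidDecay.expIntegrable [NormedSpace ℝ Y] {b : V → Y} (hb : RapidDecay Ω b)
    (hΩ : IsAdmissible Ω) (hc : Continuous b) : ExpIntegrable Ω b μ := by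
  intro m
  obtain ⟨M, hM, hint⟩ := hΩ.exists_integrable_exp_neg μ
  obtain ⟨C, hC, h⟩ := rapidDecay_iff.1 hb (|m| + M) (by positivity)
  refine (hint.const_mul C).mono' ?_ (.of_forall fun p => ?_)
  · have := hΩ.continuous
    exact Continuous.aestronglyMeasurable (by fun_prop)
  · have hm : m * Ω p + -(|m| + M) * Ω p ≤ -(M * Ω p) := by
      linarith [mul_le_mul_of_nonneg_right (le_abs_self m) (hΩ.nonneg p)]
    calc ‖Real.exp (m * Ω p) • b p‖ = Real.exp (m * Ω p) * ‖b p‖ := by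
          rw [norm_smul, Real.norm_of_nonneg (Real.exp_pos _).le]
      _ ≤ Real.exp (m * Ω p) * (C * Real.exp (-(|m| + M) * Ω p)) := by gcongr; exact h p
      _ = C * Real.exp (m * Ω p + -(|m| + M) * Ω p) := by rw [Real.exp_add]; ring
      _ ≤ C * Real.exp (-(M * Ω p)) := by gcongr

lemma RapidDecay.integral_norm_mul_norm_sub {u : V → Y} {v : V → Z} (hΩ : IsAdmissible Ω)
    (hu : RapidDecay Ω u) (hv : RapidDecay Ω v) :
    RapidDecay Ω fun x => ∫ t, ‖u t‖ * ‖v (t - x)‖ ∂μ := by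
  refine rapidDecay_iff.2 fun l hl => ?_
  obtain ⟨M, hM, hint⟩ := hΩ.exists_integrable_exp_neg μ
  obtain ⟨K, hK, hadd⟩ := hΩ.add_le
  obtain ⟨A, hA, hu⟩ := rapidDecay_iff.1 hu (M + l * K) (by positivity)
  obtain ⟨B, hB, hv⟩ := rapidDecay_iff.1 hv (l * K) (by positivity)
  set D : ℝ := A * B * Real.exp (l * K)
  have norm_mul_le (x t : V) : ‖u t‖ * ‖v (t - x)‖ ≤
      D * Real.exp (-l * Ω x) * Real.exp (-(M * Ω t)) := by
    have hx : Ω x ≤ K * (1 + Ω t + Ω (t - x)) := by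
      simpa only [hΩ.neg, ← sub_eq_add_neg, sub_sub_cancel] using hadd t (-(t - x))
    calc ‖u t‖ * ‖v (t - x)‖
        ≤ (A * Real.exp (-(M + l * K) * Ω t)) * (B * Real.exp (-(l * K) * Ω (t - x))) :=
          mul_le_mul (hu t) (hv _) (norm_nonneg _) (by positivity)
      _ = A * B * Real.exp (-(M + l * K) * Ω t + -(l * K) * Ω (t - x)) := by
          rw [Real.exp_add]; ring
      _ ≤ A * B * Real.exp (l * K + -l * Ω x + -(M * Ω t)) := by
          refine mul_le_mul_of_nonneg_left (Real.exp_le_exp.2 ?_) (by positivity)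
          linarith [mul_le_mul_of_nonneg_left hx hl.le]
      _ = D * Real.exp (-l * Ω x) * Real.exp (-(M * Ω t)) := by
          rw [Real.exp_add, Real.exp_add]; ring
  refine ⟨D * ∫ t, Real.exp (-(M * Ω t)) ∂μ + 1, by positivity, fun x => ?_⟩
  rw [Real.norm_of_nonneg (by positivity)]
  calc ∫ t, ‖u t‖ * ‖v (t - x)‖ ∂μ
      ≤ ∫ t, D * Real.exp (-l * Ω x) * Real.exp (-(M * Ω t)) ∂μ :=
        integral_mono_of_nonneg (.of_forall fun t => by positivity) (hint.const_mul _)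
          (.of_forall (norm_mul_le x))
    _ = (D * ∫ t, Real.exp (-(M * Ω t)) ∂μ) * Real.exp (-l * Ω x) := by
        rw [integral_const_mul]; ring
    _ ≤ (D * ∫ t, Real.exp (-(M * Ω t)) ∂μ + 1) * Real.exp (-l * Ω x) := by
        gcongr
        exact le_add_of_nonneg_right zero_le_one

end Integrable

section Calculus

variable {N : ℕ}

lemma multiIndex_induction {M : (Fin N → ℕ) → Prop} (zero : M 0)
    (add_single : ∀ α j, M α → M (α + Pi.single j 1)) (α : Fin N → ℕ) : M α := by
  suffices h : ∀ β, M β → M (β + α) by simpa using h 0 zero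
  induction α using Pi.single_induction with
  | zero => simp
  | add γ δ hγ hδ => exact fun β hβ => add_assoc β γ δ ▸ hδ _ (hγ β hβ)
  | single j n =>
    induction n with
    | zero => simp
    | succ n ih =>
      intro β hβ
      rw [Pi.single_add, ← add_assoc]
      exact add_single _ j (ih β hβ)

lemma fderiv_eq_sum_pderiv (f : EuclideanSpace ℝ (Fin N) → ℂ) (x : EuclideanSpace ℝ (Fin N)) :
    fderiv ℝ f x = ∑ j, (Complex.I * pderiv j f x) •
      Complex.ofRealCLM.comp (EuclideanSpace.proj j : EuclideanSpace ℝ (Fin N) →L[ℝ] ℝ) := by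
  refine ContinuousLinearMap.coe_injective
    ((EuclideanSpace.basisFun (Fin N) ℝ).toBasis.ext fun i => ?_)
  simp only [ContinuousLinearMap.coe_coe, OrthonormalBasis.coe_toBasis,
    EuclideanSpace.basisFun_apply, FunLike.coe_sum, Finset.sum_apply]
  rw [Finset.sum_eq_single i (fun j _ hj => by simp [hj]) (by simp)]
  simp [pderiv, ← mul_assoc]

lemma contDiff_of_pderiv_mem {T : Set (EuclideanSpace ℝ (Fin N) → ℂ)}
    (hT : ∀ f ∈ T, Differentiable ℝ f) (hT' : ∀ j, ∀ f ∈ T, pderiv j f ∈ T)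
    {f : EuclideanSpace ℝ (Fin N) → ℂ} (hf : f ∈ T) : ContDiff ℝ (⊤ : ℕ∞) f := by
  refine contDiff_infty.2 fun n => ?_
  induction n generalizing f with
  | zero => exact contDiff_zero.2 (hT f hf).continuous
  | succ n ih =>
    rw [Nat.cast_add_one, contDiff_succ_iff_fderiv, funext (fderiv_eq_sum_pderiv f)]
    refine ⟨hT f hf, by simp, ContDiff.sum fun j _ => ?_⟩
    exact (contDiff_const.mul (ih (hT' j f hf))).smul contDiff_const

lemma contDiff_mderiv (α : Fin N → ℕ) {u : EuclideanSpace ℝ (Fin N) → ℂ}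
    (hu : ContDiff ℝ (⊤ : ℕ∞) u) : ContDiff ℝ (⊤ : ℕ∞) (mderiv α u) :=
  mderiv_mem (T := {f | ContDiff ℝ (⊤ : ℕ∞) f}) (fun j _ => contDiff_pderiv j) α hu

lemma mderiv_comp_sub (α : Fin N → ℕ) {u : EuclideanSpace ℝ (Fin N) → ℂ}
    (hu : ContDiff ℝ (⊤ : ℕ∞) u) (y : EuclideanSpace ℝ (Fin N)) :
    mderiv α (fun t => u (t - y)) = fun t => mderiv α u (t - y) := by
  induction α using multiIndex_induction generalizing u with
  | zero => simp only [mderiv_zero]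
  | add_single α j ih =>
    have hu_sub : ContDiff ℝ (⊤ : ℕ∞) fun t => u (t - y) := hu.comp (contDiff_id.sub contDiff_const)
    have pderiv_comp_sub : pderiv j (fun t => u (t - y)) = fun t => pderiv j u (t - y) :=
      funext fun t => by simp only [pderiv, fderiv_comp_sub]
    rw [← mderiv_pderiv α j hu, ← mderiv_pderiv α j hu_sub, pderiv_comp_sub,
      ih (contDiff_pderiv j hu)]

end Calculus

section Phase

/-- The character `t ↦ exp (-i t·ξ)`. -/
def phase {V : Type*} [NormedAddCommGroup V] [InnerProductSpace ℝ V] (ξ t : V) : ℂ :=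
  Complex.exp (-(Complex.I * (inner ℝ t ξ : ℝ)))

variable {V : Type*} [NormedAddCommGroup V] [InnerProductSpace ℝ V]

lemma norm_phase (ξ t : V) : ‖phase ξ t‖ = 1 := by
  simp [phase, Complex.norm_exp]

@[fun_prop]
lemma continuous_phase : Continuous fun z : V × V => phase z.1 z.2 := by
  unfold phase
  fun_prop

variable {N : ℕ}

lemma contDiff_phase_mul (ξ : EuclideanSpace ℝ (Fin N)) {u : EuclideanSpace ℝ (Fin N) → ℂ}
    (hu : ContDiff ℝ (⊤ : ℕ∞) u) : ContDiff ℝ (⊤ : ℕ∞) (phase ξ * u) :=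
  ((contDiff_const.mul
    (Complex.ofRealCLM.contDiff.comp (contDiff_id.inner ℝ contDiff_const))).neg).cexp.mul hu

lemma pderiv_phase_mul (j : Fin N) (ξ : EuclideanSpace ℝ (Fin N))
    {u : EuclideanSpace ℝ (Fin N) → ℂ} (hu : ContDiff ℝ (⊤ : ℕ∞) u) :
    pderiv j (phase ξ * u) = phase ξ * pderiv j u + phase ξ * (-(ξ j : ℂ) • u) := by
  funext t
  have h_inner : HasFDerivAt (fun t : EuclideanSpace ℝ (Fin N) => ((inner ℝ t ξ : ℝ) : ℂ))
      (Complex.ofRealCLM.comp (innerSL ℝ ξ)) t := by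
    simp only [real_inner_comm ξ]
    exact (Complex.ofRealCLM.comp (innerSL ℝ ξ)).hasFDerivAt
  have h_phase : HasFDerivAt (phase ξ)
      (phase ξ t • -(Complex.I • Complex.ofRealCLM.comp (innerSL ℝ ξ))) t :=
    ((h_inner.const_mul Complex.I).neg).cexp
  have h_mul := (h_phase.mul (hu.differentiable (by simp) t).hasFDerivAt).fderiv
  simp only [pderiv, h_mul, add_apply, smul_apply, neg_apply, ContinuousLinearMap.comp_apply,
    innerSL_apply_apply, EuclideanSpace.inner_single_right, Complex.ofRealCLM_apply, smul_eq_mul,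
    Pi.add_apply, Pi.mul_apply, Pi.smul_apply, conj_trivial, one_mul]
  linear_combination (phase ξ t * u t * (ξ j : ℂ)) * Complex.I_mul_I

end Phase

section ModerateGrowth

variable {P : Type*}

/-- `q` grows at most like a power of `exp W`. -/
def ModerateGrowth (W : P → ℝ) (q : P → ℂ) : Prop :=
  ∃ C m : ℝ, 0 ≤ C ∧ ∀ p, ‖q p‖ ≤ C * Real.exp (m * W p)

lemma IsAdmissible.moderateGrowth {V : Type*} [NormedAddCommGroup V] {Ω : V → ℝ}
    (hΩ : IsAdmissible Ω) {W : P → ℝ} {y : P → V} (hy : ∀ p, Ω (y p) ≤ W p) {q : P → ℂ}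
    (hq : ∀ p, ‖q p‖ ≤ ‖y p‖) : ModerateGrowth W q := by
  obtain ⟨C, k, hk, h⟩ := hΩ.one_add_norm_le
  have hC : 0 ≤ C := by
    have h₀ : 0 ≤ C * Real.exp (k * Ω 0) := le_trans (by positivity) (h 0)
    exact nonneg_of_mul_nonneg_left h₀ (Real.exp_pos _)
  refine ⟨C, k, hC, fun p => (hq p).trans ?_⟩
  calc ‖y p‖ ≤ C * Real.exp (k * Ω (y p)) := by linarith [h (y p)]
    _ ≤ C * Real.exp (k * W p) := by gcongr; exact hy p

variable [TopologicalSpace P]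

/-- Families of functions on `V`, jointly continuous in the parameter and the variable, whose norms
weighted by the powers of `exp Ω` grow at most like a power of `exp W` in the parameter. -/
structure IsModerate {V : Type*} [TopologicalSpace V] (Ω : V → ℝ) (W : P → ℝ)
    (F : P → V → ℂ) : Prop where
  continuous : Continuous fun z : P × V => F z.1 z.2
  bound : ∀ l, 0 < l → ∃ C m : ℝ, 0 ≤ C ∧
    ∀ p t, Real.exp (l * Ω t) * ‖F p t‖ ≤ C * Real.exp (m * W p)

section Topological

variable {V : Type*} [TopologicalSpace V] {Ω : V → ℝ} {W : P → ℝ} {F G : P → V → ℂ}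

lemma IsModerate.smul {q : P → ℂ} (hq : Continuous q) (hq' : ModerateGrowth W q)
    (hF : IsModerate Ω W F) : IsModerate Ω W fun p => q p • F p where
  continuous := (hq.comp continuous_fst).mul hF.continuous
  bound l hl := by
    obtain ⟨A, m, hA, h⟩ := hq'
    obtain ⟨B, n, hB, h'⟩ := hF.bound l hl
    refine ⟨A * B, m + n, by positivity, fun p t => ?_⟩
    calc Real.exp (l * Ω t) * ‖(q p • F p) t‖ = ‖q p‖ * (Real.exp (l * Ω t) * ‖F p t‖) := by
          rw [Pi.smul_apply, norm_smul]; ring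
      _ ≤ (A * Real.exp (m * W p)) * (B * Real.exp (n * W p)) :=
          mul_le_mul (h p) (h' p t) (by positivity) (by positivity)
      _ = A * B * Real.exp ((m + n) * W p) := by rw [add_mul, Real.exp_add]; ring

lemma IsModerate.add (hW : ∀ p, 0 ≤ W p) (hF : IsModerate Ω W F) (hG : IsModerate Ω W G) :
    IsModerate Ω W fun p => F p + G p where
  continuous := hF.continuous.add hG.continuous
  bound l hl := by
    obtain ⟨A, m, hA, h⟩ := hF.bound l hl
    obtain ⟨B, n, hB, h'⟩ := hG.bound l hl
    refine ⟨A + B, max m n, by positivity, fun p t => ?_⟩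
    have := hW p
    calc Real.exp (l * Ω t) * ‖(F p + G p) t‖
        ≤ Real.exp (l * Ω t) * ‖F p t‖ + Real.exp (l * Ω t) * ‖G p t‖ := by
          rw [← mul_add]; gcongr; exact norm_add_le _ _
      _ ≤ A * Real.exp (m * W p) + B * Real.exp (n * W p) := add_le_add (h p t) (h' p t)
      _ ≤ A * Real.exp (max m n * W p) + B * Real.exp (max m n * W p) := by
          gcongr
          exacts [le_max_left m n, le_max_right m n]
      _ = (A + B) * Real.exp (max m n * W p) := by ring

end Topological

lemma IsModerate.phase_mul {V : Type*} [NormedAddCommGroup V] [InnerProductSpace ℝ V] {Ω : V → ℝ}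
    {W : P → ℝ} {F : P → V → ℂ} (hF : IsModerate Ω W F) {ζ : P → V} (hζ : Continuous ζ) :
    IsModerate Ω W fun p => phase (ζ p) * F p where
  continuous := by
    have := hF.continuous
    simp only [Pi.mul_apply]
    fun_prop
  bound l hl := by simpa only [Pi.mul_apply, norm_mul, norm_phase, one_mul] using hF.bound l hl

variable {V : Type*} [NormedAddCommGroup V] {Ω : V → ℝ} {W : P → ℝ}

lemma RapidDecay.isModerate_comp_sub {u : V → ℂ} (hu : RapidDecay Ω u) (hc : Continuous u)
    (hΩ : IsAdmissible Ω) {y : P → V} (hy : Continuous y) (hyW : ∀ p, Ω (y p) ≤ W p) :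
    IsModerate Ω W fun p t => u (t - y p) where
  continuous := by fun_prop
  bound l hl := by
    obtain ⟨K, hK, hadd⟩ := hΩ.add_le
    obtain ⟨C, hC, h⟩ := rapidDecay_iff.1 hu (l * K) (by positivity)
    refine ⟨C * Real.exp (l * K), l * K, by positivity, fun p t => ?_⟩
    have weight_le : l * Ω t ≤ l * K + l * K * W p + l * K * Ω (t - y p) := by
      have ht := hadd (t - y p) (y p)
      rw [sub_add_cancel] at ht
      linarith [mul_le_mul_of_nonneg_left ht hl.le,
        mul_le_mul_of_nonneg_left (hyW p) (mul_pos hl hK).le]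
    calc Real.exp (l * Ω t) * ‖u (t - y p)‖
        ≤ Real.exp (l * K + l * K * W p + l * K * Ω (t - y p)) *
          (C * Real.exp (-(l * K) * Ω (t - y p))) := by gcongr; exact h _
      _ = C * Real.exp (l * K) * Real.exp (l * K * W p) *
          Real.exp (l * K * Ω (t - y p) + -(l * K) * Ω (t - y p)) := by
          rw [Real.exp_add, Real.exp_add, Real.exp_add]; ring
      _ = C * Real.exp (l * K) * Real.exp (l * K * W p) := by simp

lemma IsModerate.exists_isCompact_bound [ProperSpace V] {F : P → V → ℂ} (hF : IsModerate Ω W F)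
    (hΩ : IsAdmissible Ω) (hW : Continuous W) {l : ℝ} (hl : 0 < l) (p₀ : P) {ε : ℝ} (hε : 0 < ε) :
    ∃ K, IsCompact K ∧ ∀ᶠ p in 𝓝 p₀, ∀ t ∉ K, Real.exp (l * Ω t) * ‖F p t‖ ≤ ε := by
  obtain ⟨C, k, hk, hnorm⟩ := hΩ.one_add_norm_le
  obtain ⟨A, m, _, h⟩ := hF.bound (l + k) (by positivity)
  set B : ℝ := A * Real.exp (m * W p₀) + 1
  have hB : ∀ᶠ p in 𝓝 p₀, A * Real.exp (m * W p) < B :=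
    (by fun_prop : Continuous fun p => A * Real.exp (m * W p)).continuousAt.eventually_lt
      continuousAt_const (lt_add_one _)
  refine ⟨Metric.closedBall 0 (C * B / ε), isCompact_closedBall _ _, hB.mono fun p hp t ht => ?_⟩
  rw [mem_closedBall_zero_iff, not_le, div_lt_iff₀ hε] at ht
  refine le_of_mul_le_mul_right ?_ (by positivity : 0 < 1 + ‖t‖)
  have h_exp : Real.exp ((l + k) * Ω t) * ‖F p t‖ ≤ B := (h p t).trans hp.le
  have hC : 0 ≤ C := nonneg_of_mul_nonneg_left
    (le_trans (by positivity) (hnorm t) : 0 ≤ C * Real.exp (k * Ω t)) (Real.exp_pos _)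
  calc Real.exp (l * Ω t) * ‖F p t‖ * (1 + ‖t‖)
      ≤ Real.exp (l * Ω t) * ‖F p t‖ * (C * Real.exp (k * Ω t)) := by gcongr; exact hnorm t
    _ = C * (Real.exp ((l + k) * Ω t) * ‖F p t‖) := by rw [add_mul, Real.exp_add]; ring
    _ ≤ C * B := by gcongr
    _ ≤ ε * (1 + ‖t‖) := by linarith

end ModerateGrowth

lemma continuous_of_eventually_norm_le {P X E : Type*} [TopologicalSpace P] [TopologicalSpace X]
    [NormedAddCommGroup E] {u : P → X →ᵇ E} (hu : Continuous fun z : P × X => u z.1 z.2)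
    (h : ∀ p₀, ∀ ε > 0, ∃ K, IsCompact K ∧ ∀ᶠ p in 𝓝 p₀, ∀ t ∉ K, ‖u p t‖ ≤ ε) :
    Continuous u := by
  refine continuous_iff_continuousAt.2 fun p₀ => Metric.tendsto_nhds.2 fun ε hε => ?_
  obtain ⟨K, hK, h_off⟩ := h p₀ (ε / 4) (by positivity)
  have h_on : ∀ᶠ p in 𝓝 p₀, ∀ t ∈ K, dist (u p t) (u p₀ t) < ε / 2 := by
    refine hK.eventually_forall_of_forall_eventually fun t _ => ?_
    have hc : Continuous fun z : P × X => dist (u z.1 z.2) (u p₀ z.2) := by fun_prop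
    exact hc.continuousAt.eventually_lt continuousAt_const (by simpa using hε)
  filter_upwards [h_on, h_off] with p hp_on hp_off
  refine ((BoundedContinuousFunction.dist_le (by positivity)).2 fun t => ?_).trans_lt
    (half_lt_self hε)
  by_cases ht : t ∈ K
  · exact (hp_on t ht).le
  · calc dist (u p t) (u p₀ t) ≤ ‖u p t‖ + ‖u p₀ t‖ := dist_le_norm_add_norm _ _
      _ ≤ ε / 4 + ε / 4 := add_le_add (hp_off t ht) (h_off.self_of_nhds t ht)
      _ = ε / 2 := by ring

section ModerateFamily

variable {N : ℕ} {P : Type*} [TopologicalSpace P]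

/-- Families of smooth functions on `ℝ^N` whose derivatives of every order form moderate families:
the families over which the parameter integrals below converge in the weighted spaces. -/
structure ModerateFamily (Ω : EuclideanSpace ℝ (Fin N) → ℝ) (W : P → ℝ)
    (ψ : P → EuclideanSpace ℝ (Fin N) → ℂ) : Prop where
  contDiff : ∀ p, ContDiff ℝ (⊤ : ℕ∞) (ψ p)
  mderiv : ∀ α, IsModerate Ω W fun p => mderiv α (ψ p)

variable {Ω : EuclideanSpace ℝ (Fin N) → ℝ} {W : P → ℝ} {ψ : P → EuclideanSpace ℝ (Fin N) → ℂ}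

lemma ModerateFamily.isModerate (hψ : ModerateFamily Ω W ψ) : IsModerate Ω W ψ := by
  simpa only [mderiv_zero] using hψ.mderiv 0

lemma ModerateFamily.pderiv (hψ : ModerateFamily Ω W ψ) (j : Fin N) :
    ModerateFamily Ω W fun p => pderiv j (ψ p) where
  contDiff p := contDiff_pderiv j (hψ.contDiff p)
  mderiv α := by simpa only [mderiv_pderiv α j (hψ.contDiff _)] using hψ.mderiv (α + Pi.single j 1)

lemma ModerateFamily.smul (hψ : ModerateFamily Ω W ψ) {q : P → ℂ} (hq : Continuous q)
    (hq' : ModerateGrowth W q) : ModerateFamily Ω W fun p => q p • ψ p where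
  contDiff p := (hψ.contDiff p).const_smul (q p)
  mderiv α := by simpa only [mderiv_smul α _ (hψ.contDiff _)] using (hψ.mderiv α).smul hq hq'

lemma ModerateFamily.phase_mul (hψ : ModerateFamily Ω W ψ) (hW : ∀ p, 0 ≤ W p)
    {ζ : P → EuclideanSpace ℝ (Fin N)} (hζ : Continuous ζ)
    (hζW : ∀ j, ModerateGrowth W fun p => -(ζ p j : ℂ)) :
    ModerateFamily Ω W fun p => phase (ζ p) * ψ p where
  contDiff p := contDiff_phase_mul _ (hψ.contDiff p)
  mderiv α := by
    induction α using multiIndex_induction generalizing ψ with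
    | zero => simpa only [mderiv_zero] using hψ.isModerate.phase_mul hζ
    | add_single α j ih =>
      have hψ₁ := hψ.pderiv j
      have hψ₂ := hψ.smul (q := fun p => -(ζ p j : ℂ)) (by fun_prop) (hζW j)
      convert (ih hψ₁).add hW (ih hψ₂) using 2 with p
      rw [← mderiv_pderiv α j (contDiff_phase_mul _ (hψ.contDiff p)),
        pderiv_phase_mul j (ζ p) (hψ.contDiff p),
        mderiv_add α (contDiff_phase_mul _ (hψ₁.contDiff p))
          (contDiff_phase_mul _ (hψ₂.contDiff p))]

lemma WeightedSmooth.moderateFamily_comp_sub {u : EuclideanSpace ℝ (Fin N) → ℂ}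
    (hu : WeightedSmooth Ω u) (hΩ : IsAdmissible Ω) {y : P → EuclideanSpace ℝ (Fin N)}
    (hy : Continuous y) (hyW : ∀ p, Ω (y p) ≤ W p) :
    ModerateFamily Ω W fun p t => u (t - y p) where
  contDiff p := hu.1.comp (contDiff_id.sub contDiff_const)
  mderiv α := by
    have hα : RapidDecay Ω (Beurling.mderiv α u) := fun l hl => hu.2 l hl α
    simpa only [mderiv_comp_sub α hu.1] using
      hα.isModerate_comp_sub (contDiff_mderiv α hu.1).continuous hΩ hy hyW

end ModerateFamily

section ParameterIntegral

lemma norm_fderiv_le_sum_pderiv {N : ℕ} (f : EuclideanSpace ℝ (Fin N) → ℂ)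
    (x : EuclideanSpace ℝ (Fin N)) : ‖fderiv ℝ f x‖ ≤ ∑ j, ‖pderiv j f x‖ := by
  rw [fderiv_eq_sum_pderiv]
  refine (norm_sum_le _ _).trans (Finset.sum_le_sum fun j _ => ?_)
  rw [norm_smul, norm_mul, Complex.norm_I, one_mul]
  refine mul_le_of_le_one_right (norm_nonneg _)
    (ContinuousLinearMap.opNorm_le_bound _ zero_le_one fun v => ?_)
  simpa using PiLp.norm_apply_le v j

variable {P : Type*} [TopologicalSpace P] [MeasurableSpace P] {μ : Measure P} {W : P → ℝ}
  {b : P → ℂ}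

lemma IsModerate.exists_integrable_bound {V : Type*} [TopologicalSpace V] {Ω : V → ℝ}
    {F : P → V → ℂ} (hF : IsModerate Ω W F) (hb : ExpIntegrable W b μ) {l : ℝ} (hl : 0 < l) :
    ∃ B : P → ℝ, Integrable B μ ∧ ∀ p t, Real.exp (l * Ω t) * ‖b p * F p t‖ ≤ B p := by
  obtain ⟨C, m, -, h⟩ := hF.bound l hl
  refine ⟨fun p => C * ‖Real.exp (m * W p) • b p‖, (hb m).norm.const_mul C, fun p t => ?_⟩
  calc Real.exp (l * Ω t) * ‖b p * F p t‖
      = ‖b p‖ * (Real.exp (l * Ω t) * ‖F p t‖) := by rw [norm_mul]; ring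
    _ ≤ ‖b p‖ * (C * Real.exp (m * W p)) := mul_le_mul_of_nonneg_left (h p t) (norm_nonneg _)
    _ = C * ‖Real.exp (m * W p) • b p‖ := by
        rw [norm_smul, Real.norm_of_nonneg (Real.exp_pos _).le]; ring

lemma IsModerate.exists_integrable_norm_bound {V : Type*} [TopologicalSpace V] {Ω : V → ℝ}
    {F : P → V → ℂ} (hF : IsModerate Ω W F) (hΩ : ∀ t, 0 ≤ Ω t) (hb : ExpIntegrable W b μ) :
    ∃ B : P → ℝ, Integrable B μ ∧ ∀ p t, ‖b p * F p t‖ ≤ B p := by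
  obtain ⟨B, hB, h⟩ := hF.exists_integrable_bound hb one_pos
  exact ⟨B, hB, fun p t => (le_mul_of_one_le_left (norm_nonneg _)
    (Real.one_le_exp (mul_nonneg zero_le_one (hΩ t)))).trans (h p t)⟩

variable [OpensMeasurableSpace P]

lemma IsModerate.aestronglyMeasurable_mul {V : Type*} [TopologicalSpace V] {Ω : V → ℝ}
    {F : P → V → ℂ} (hF : IsModerate Ω W F) (hb : ExpIntegrable W b μ) (t : V) :
    AEStronglyMeasurable (fun p => b p * F p t) μ :=
  hb.integrable.aestronglyMeasurable.mul
    (hF.continuous.comp (Continuous.prodMk_left t)).aestronglyMeasurable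

lemma IsModerate.integrable_mul {V : Type*} [TopologicalSpace V] {Ω : V → ℝ}
    {F : P → V → ℂ} (hF : IsModerate Ω W F) (hΩ : ∀ t, 0 ≤ Ω t) (hb : ExpIntegrable W b μ)
    (t : V) : Integrable (fun p => b p * F p t) μ := by
  obtain ⟨B, hB, h⟩ := hF.exists_integrable_norm_bound hΩ hb
  exact hB.mono' (hF.aestronglyMeasurable_mul hb t) (.of_forall fun p => h p t)

lemma IsModerate.integrable_prod_mul {V : Type*} [NormedAddCommGroup V] [NormedSpace ℝ V]
    [FiniteDimensional ℝ V] [MeasurableSpace V] [BorelSpace V] {Ω : V → ℝ}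
    {F : P → V → ℂ} (hF : IsModerate Ω W F) (hΩ : IsAdmissible Ω) (hb : ExpIntegrable W b μ)
    (ν : Measure V) [ν.IsAddHaarMeasure] [SFinite μ] [SecondCountableTopology P] :
    Integrable (fun z : V × P => b z.2 * F z.2 z.1) (ν.prod μ) := by
  obtain ⟨M, hM, h_exp⟩ := hΩ.exists_integrable_exp_neg ν
  obtain ⟨B, hB, h⟩ := hF.exists_integrable_bound hb hM
  have : ProperSpace V := .of_locallyCompactSpace ℝ
  refine (h_exp.mul_prod hB).mono' (hb.integrable.aestronglyMeasurable.comp_snd.mul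
    (hF.continuous.comp continuous_swap).aestronglyMeasurable) (.of_forall fun z => ?_)
  rw [Real.exp_neg, ← div_eq_inv_mul, le_div_iff₀' (Real.exp_pos _)]
  exact h z.2 z.1

variable {N : ℕ} {Ω : EuclideanSpace ℝ (Fin N) → ℝ} {ψ : P → EuclideanSpace ℝ (Fin N) → ℂ}

lemma ModerateFamily.hasFDerivAt_integral (hψ : ModerateFamily Ω W ψ) (hΩ : ∀ t, 0 ≤ Ω t)
    (hb : ExpIntegrable W b μ) (t : EuclideanSpace ℝ (Fin N)) :
    Integrable (fun p => b p • fderiv ℝ (ψ p) t) μ ∧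
      HasFDerivAt (fun t => ∫ p, b p * ψ p t ∂μ) (∫ p, b p • fderiv ℝ (ψ p) t ∂μ) t := by
  choose B hB hbB using fun j => (hψ.pderiv j).isModerate.exists_integrable_norm_bound hΩ hb
  have bound (p : P) (t : EuclideanSpace ℝ (Fin N)) :
      ‖b p • fderiv ℝ (ψ p) t‖ ≤ ∑ j, B j p := by
    calc ‖b p • fderiv ℝ (ψ p) t‖ ≤ ‖b p‖ * ∑ j, ‖Beurling.pderiv j (ψ p) t‖ := by
          rw [norm_smul]; gcongr; exact norm_fderiv_le_sum_pderiv _ _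
      _ ≤ ∑ j, B j p := by
          rw [Finset.mul_sum]
          exact Finset.sum_le_sum fun j _ => (norm_mul _ _).symm.trans_le (hbB j p t)
  have measurable_fderiv : AEStronglyMeasurable (fun p => b p • fderiv ℝ (ψ p) t) μ := by
    simp only [fderiv_eq_sum_pderiv, Finset.smul_sum, smul_smul, mul_left_comm (b _)]
    exact Finset.aestronglyMeasurable_fun_sum _ fun j _ =>
      (((hψ.pderiv j).isModerate.aestronglyMeasurable_mul hb t).const_mul _).smul_const _
  have integrable_bound : Integrable (fun p => ∑ j, B j p) μ :=
    integrable_finsetSum _ fun j _ => hB j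
  exact ⟨integrable_bound.mono' measurable_fderiv (.of_forall fun p => bound p t),
    hasFDerivAt_integral_of_dominated_of_fderiv_le Filter.univ_mem
      (.of_forall fun t => hψ.isModerate.aestronglyMeasurable_mul hb t)
      (hψ.isModerate.integrable_mul hΩ hb t) measurable_fderiv
      (.of_forall fun p t _ => bound p t) integrable_bound
      (.of_forall fun p t _ =>
        ((hψ.contDiff p).differentiable (by simp) t).hasFDerivAt.const_mul (b p))⟩

lemma ModerateFamily.pderiv_integral (hψ : ModerateFamily Ω W ψ) (hΩ : ∀ t, 0 ≤ Ω t)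
    (hb : ExpIntegrable W b μ) (j : Fin N) :
    Beurling.pderiv j (fun t => ∫ p, b p * ψ p t ∂μ) =
      fun t => ∫ p, b p * Beurling.pderiv j (ψ p) t ∂μ := by
  funext t
  obtain ⟨h_int, h_deriv⟩ := hψ.hasFDerivAt_integral hΩ hb t
  simp only [Beurling.pderiv, h_deriv.fderiv, ContinuousLinearMap.integral_apply h_int,
    smul_apply, smul_eq_mul, ← integral_const_mul, mul_left_comm (b _)]

lemma ModerateFamily.contDiff_integral (hψ : ModerateFamily Ω W ψ) (hΩ : ∀ t, 0 ≤ Ω t)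
    (hb : ExpIntegrable W b μ) : ContDiff ℝ (⊤ : ℕ∞) fun t => ∫ p, b p * ψ p t ∂μ := by
  refine contDiff_of_pderiv_mem
    (T := {u | ∃ χ, ModerateFamily Ω W χ ∧ u = fun t => ∫ p, b p * χ p t ∂μ}) ?_ ?_ ⟨ψ, hψ, rfl⟩
  · rintro _ ⟨χ, hχ, rfl⟩ t
    exact (hχ.hasFDerivAt_integral hΩ hb t).2.differentiableAt
  · rintro j _ ⟨χ, hχ, rfl⟩
    exact ⟨_, hχ.pderiv j, hχ.pderiv_integral hΩ hb j⟩

lemma ModerateFamily.mderiv_integral (hψ : ModerateFamily Ω W ψ) (hΩ : ∀ t, 0 ≤ Ω t)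
    (hb : ExpIntegrable W b μ) (α : Fin N → ℕ) :
    Beurling.mderiv α (fun t => ∫ p, b p * ψ p t ∂μ) =
      fun t => ∫ p, b p * Beurling.mderiv α (ψ p) t ∂μ := by
  induction α using multiIndex_induction generalizing ψ with
  | zero => simp only [mderiv_zero]
  | add_single α j ih =>
    rw [← mderiv_pderiv α j (hψ.contDiff_integral hΩ hb), hψ.pderiv_integral hΩ hb,
      ih (hψ.pderiv j)]
    simp only [mderiv_pderiv α j (hψ.contDiff _)]

lemma ModerateFamily.weightedSmooth_integral (hψ : ModerateFamily Ω W ψ) (hΩ : ∀ t, 0 ≤ Ω t)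
    (hb : ExpIntegrable W b μ) : WeightedSmooth Ω fun t => ∫ p, b p * ψ p t ∂μ := by
  refine ⟨hψ.contDiff_integral hΩ hb, fun l hl α => ?_⟩
  obtain ⟨B, hB, h⟩ := (hψ.mderiv α).exists_integrable_bound hb hl
  refine ⟨∫ p, B p ∂μ, fun t => ?_⟩
  rw [hψ.mderiv_integral hΩ hb α]
  calc Real.exp (l * Ω t) * ‖∫ p, b p * Beurling.mderiv α (ψ p) t ∂μ‖
      ≤ Real.exp (l * Ω t) * ∫ p, ‖b p * Beurling.mderiv α (ψ p) t‖ ∂μ := by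
        gcongr; exact norm_integral_le_integral_norm _
    _ = ∫ p, Real.exp (l * Ω t) * ‖b p * Beurling.mderiv α (ψ p) t‖ ∂μ :=
        (integral_const_mul _ _).symm
    _ ≤ ∫ p, B p ∂μ :=
        integral_mono_of_nonneg (.of_forall fun p => by positivity) hB (.of_forall fun p => h p t)

lemma ModerateFamily.fourierT_integral [SFinite μ] [SecondCountableTopology P]
    (hψ : ModerateFamily Ω W ψ) (hΩ : IsAdmissible Ω) (hb : ExpIntegrable W b μ) :
    fourierT (fun t => ∫ p, b p * ψ p t ∂μ) = fun ξ => ∫ p, b p * fourierT (ψ p) ξ ∂μ := by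
  funext ξ
  have h_int : Integrable (fun z : EuclideanSpace ℝ (Fin N) × P =>
      phase ξ z.1 * (b z.2 * ψ z.2 z.1)) (volume.prod μ) :=
    (hψ.isModerate.integrable_prod_mul hΩ hb volume).bdd_mul (c := 1)
      (by fun_prop : Continuous fun t => phase ξ t).aestronglyMeasurable.comp_fst
      (.of_forall fun z => (norm_phase ξ z.1).le)
  calc fourierT (fun t => ∫ p, b p * ψ p t ∂μ) ξ
      = ∫ t, ∫ p, phase ξ t * (b p * ψ p t) ∂μ := by simp only [integral_const_mul]; rfl
    _ = ∫ p, (∫ t, phase ξ t * (b p * ψ p t)) ∂μ := integral_integral_swap h_int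
    _ = ∫ p, b p * fourierT (ψ p) ξ ∂μ := by
        simp only [mul_left_comm (phase ξ _), integral_const_mul]; rfl

end ParameterIntegral

section FourierTransform

variable {N : ℕ} {u v : EuclideanSpace ℝ (Fin N) → ℂ}

lemma fourierT_eq_fourierIntegral (u : EuclideanSpace ℝ (Fin N) → ℂ) :
    fourierT u = VectorFourier.fourierIntegral Real.probChar volume
      (innerₗ (EuclideanSpace ℝ (Fin N))) u := by
  funext ξ
  simp only [fourierT, VectorFourier.fourierIntegral_probChar, innerₗ_apply_apply, smul_eq_mul,
    mul_comm Complex.I, neg_mul]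

lemma fourierT_two_pi_smul (u : EuclideanSpace ℝ (Fin N) → ℂ) (w : EuclideanSpace ℝ (Fin N)) :
    fourierT u ((2 * Real.pi) • w) = 𝓕 u w := by
  rw [Real.fourier_eq', fourierT]
  congr! 4 with v
  rw [inner_smul_right]
  push_cast
  ring

lemma fourierT_comp_neg (u : EuclideanSpace ℝ (Fin N) → ℂ) (ξ : EuclideanSpace ℝ (Fin N)) :
    fourierT (fun t => u (-t)) ξ = fourierT u (-ξ) := by
  rw [fourierT, ← integral_neg_eq_self]
  simp only [neg_neg, inner_neg_left, fourierT, inner_neg_right]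

lemma integral_fourierT_mul (hu : Integrable u) (hv : Integrable v) :
    ∫ ξ, fourierT u ξ * v ξ = ∫ x, u x * fourierT v x := by
  simpa only [fourierT_eq_fourierIntegral, smul_eq_mul, flip_innerₗ] using
    VectorFourier.integral_fourierIntegral_smul_eq_flip (L := innerₗ (EuclideanSpace ℝ (Fin N)))
      Real.continuous_probChar continuous_inner hu hv

lemma fourierT_fourierT (hc : Continuous u) (hu : Integrable u) (hu' : Integrable (fourierT u))
    (t : EuclideanSpace ℝ (Fin N)) :
    fourierT (fourierT u) t = (2 * Real.pi : ℂ) ^ N * u (-t) := by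
  have h_int : Integrable (𝓕 u) := by
    simpa only [fourierT_two_pi_smul] using hu'.comp_smul Real.two_pi_pos.ne'
  have h_inv : ∫ w, phase t ((2 * Real.pi) • w) * fourierT u ((2 * Real.pi) • w) = u (-t) := by
    rw [← congrFun (hc.fourierInv_fourier_eq hu h_int) (-t), Real.fourierInv_eq']
    congr! 2 with w
    rw [phase, fourierT_two_pi_smul, real_inner_smul_left, inner_neg_right, smul_eq_mul]
    congr 2
    push_cast
    ring
  have h_scale := Measure.integral_comp_smul volume (fun η => phase t η * fourierT u η)
    (2 * Real.pi)
  rw [h_inv, finrank_euclideanSpace_fin, abs_of_pos (by positivity), Complex.real_smul] at h_scale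
  rw [h_scale, ← mul_assoc]
  push_cast
  rw [mul_inv_cancel₀ (by simp [Real.pi_ne_zero]), one_mul]
  rfl

lemma integral_mul_eq_integral_fourierT (hc : Continuous u) (hu : Integrable u)
    (hu' : Integrable (fourierT u)) (hv : Integrable v) :
    (2 * Real.pi : ℂ) ^ N * ∫ t, u t * v t = ∫ η, fourierT u η * fourierT v (-η) := by
  calc (2 * Real.pi : ℂ) ^ N * ∫ t, u t * v t
      = ∫ t, fourierT (fourierT u) t * v (-t) := by
        rw [← integral_neg_eq_self]
        simp only [fourierT_fourierT hc hu hu', mul_assoc, integral_const_mul]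
    _ = ∫ η, fourierT u η * fourierT v (-η) := by
        rw [integral_fourierT_mul hu' hv.comp_neg]
        simp only [fourierT_comp_neg]

end FourierTransform

section Factorization

variable {𝕜 V B P : Type*} [RCLike 𝕜] [AddCommGroup V] [Module 𝕜 V] [NormedAddCommGroup B]
  [NormedSpace 𝕜 B]

lemma exists_continuousLinearMap_comp_eq (J : V →ₗ[𝕜] B) (f : V →ₗ[𝕜] 𝕜) {C : ℝ}
    (hf : ∀ v, ‖f v‖ ≤ C * ‖J v‖) : ∃ G : B →L[𝕜] 𝕜, ∀ v, f v = G (J v) := by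
  have ker_le : f ∈ J.ker.dualAnnihilator := by
    refine (Submodule.mem_dualAnnihilator f).2 fun v hv => norm_le_zero_iff.1 ?_
    simpa only [LinearMap.mem_ker.1 hv, norm_zero, mul_zero] using hf v
  obtain ⟨F, rfl⟩ := (LinearMap.range_dualMap_eq_dualAnnihilator_ker J).symm ▸ ker_le
  obtain ⟨G, hG, -⟩ := exists_extension_norm_eq J.range
    ((F.comp J.range.subtype).mkContinuous C (by rintro ⟨_, v, rfl⟩; exact hf v))
  exact ⟨G, fun v => (hG ⟨J v, v, rfl⟩).symm⟩

variable {ι : Type*} [TopologicalSpace V] {q : SeminormFamily 𝕜 V ι}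

lemma exists_continuousLinearMap_pi_eq (hq : WithSeminorms q) {J : ι → V →ₗ[𝕜] B}
    (hJ : ∀ i v, ‖J i v‖ = q i v) (f : V →L[𝕜] 𝕜) :
    ∃ (s : Finset ι) (G : (s → B) →L[𝕜] 𝕜), ∀ v, f v = G fun i => J i v := by
  obtain ⟨s, C, -, hC⟩ := Seminorm.bound_of_continuous hq
    ((normSeminorm 𝕜 𝕜).comp f.toLinearMap) (continuous_norm.comp f.continuous)
  obtain ⟨G, hG⟩ := exists_continuousLinearMap_comp_eq (LinearMap.pi fun i : s => J i)
    f.toLinearMap (C := C) fun v => (hC v).trans <|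
      mul_le_mul_of_nonneg_left (Seminorm.finset_sup_apply_le (norm_nonneg _) fun i hi => by
        rw [← hJ]
        exact norm_le_pi_norm (fun i : s => J i v) ⟨i, hi⟩) C.coe_nonneg
  exact ⟨s, G, hG⟩

lemma continuous_apply_of_seminorms (hq : WithSeminorms q) {J : ι → V →ₗ[𝕜] B}
    (hJ : ∀ i v, ‖J i v‖ = q i v) (f : V →L[𝕜] 𝕜) [TopologicalSpace P] {ψ : P → V}
    (hψ : ∀ i, Continuous fun p => J i (ψ p)) : Continuous fun p => f (ψ p) := by
  obtain ⟨s, G, hG⟩ := exists_continuousLinearMap_pi_eq hq hJ f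
  simp only [hG]
  exact G.continuous.comp (continuous_pi fun i => hψ i)

lemma apply_eq_integral_of_seminorms [NormedSpace ℝ B] [CompleteSpace B] [MeasurableSpace P]
    {μ : Measure P} (hq : WithSeminorms q) {J : ι → V →ₗ[𝕜] B} (hJ : ∀ i v, ‖J i v‖ = q i v)
    (f : V →L[𝕜] 𝕜) {ψ : P → V} (hψ : ∀ i, Integrable (fun p => J i (ψ p)) μ) {v : V}
    (hv : ∀ i, J i v = ∫ p, J i (ψ p) ∂μ) : f v = ∫ p, f (ψ p) ∂μ := by
  obtain ⟨s, G, hG⟩ := exists_continuousLinearMap_pi_eq hq hJ f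
  have integral_pi : (fun i : s => J i v) = ∫ p, (fun i : s => J i (ψ p)) ∂μ :=
    funext fun i => (hv i).trans (eval_integral (fun i : s => hψ i) i).symm
  simp only [hG]
  rw [integral_pi, G.integral_comp_comm (.of_eval fun i : s => hψ i)]

end Factorization

section WeightedDeriv

variable {N : ℕ} {Ω : EuclideanSpace ℝ (Fin N) → ℝ}

/-- The vector space of the functions satisfying `WeightedSmooth Ω`. -/
def weightedSmoothSubmodule (Ω : EuclideanSpace ℝ (Fin N) → ℝ) :
    Submodule ℂ (EuclideanSpace ℝ (Fin N) → ℂ) where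
  carrier := {f | WeightedSmooth Ω f}
  add_mem' := WeightedSmooth.add
  zero_mem' := WeightedSmooth.zero Ω
  smul_mem' c _ := WeightedSmooth.smul c

/-- `f ↦ exp((n+1)Ω) D^α f`, with values in the bounded continuous functions: its norm is the
seminorm `weightedSup Ω n α`. -/
def weightedDeriv (hΩ : Continuous Ω) (n : ℕ) (α : Fin N → ℕ) :
    weightedSmoothSubmodule Ω →ₗ[ℂ] (EuclideanSpace ℝ (Fin N) →ᵇ ℂ) where
  toFun f := .ofNormedAddCommGroup
    (fun x => (Real.exp (((n : ℝ) + 1) * Ω x) : ℂ) * mderiv α f x)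
    (by have := (contDiff_mderiv α f.2.1).continuous; fun_prop) (weightedSup Ω n α f) fun x => by
      rw [norm_mul, Complex.norm_real, Real.norm_of_nonneg (Real.exp_pos _).le]
      exact le_ciSup (bddAbove_of_weightedSmooth f.2 n α) x
  map_add' f g := by
    ext x
    simp only [BoundedContinuousFunction.coe_ofNormedAddCommGroup, Submodule.coe_add,
      mderiv_add α f.2.1 g.2.1, Pi.add_apply, mul_add, BoundedContinuousFunction.add_apply]
  map_smul' c f := by
    ext x
    simp only [BoundedContinuousFunction.coe_ofNormedAddCommGroup, Submodule.coe_smul,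
      mderiv_smul α c f.2.1, Pi.smul_apply, smul_eq_mul, mul_left_comm, RingHom.id_apply,
      BoundedContinuousFunction.smul_apply]

lemma weightedDeriv_apply (hΩ : Continuous Ω) (n : ℕ) (α : Fin N → ℕ)
    (f : weightedSmoothSubmodule Ω) (x : EuclideanSpace ℝ (Fin N)) :
    weightedDeriv hΩ n α f x = (Real.exp (((n : ℝ) + 1) * Ω x) : ℂ) * mderiv α f x := rfl

lemma norm_weightedDeriv_apply (hΩ : Continuous Ω) (n : ℕ) (α : Fin N → ℕ)
    (f : weightedSmoothSubmodule Ω) (x : EuclideanSpace ℝ (Fin N)) :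
    ‖weightedDeriv hΩ n α f x‖ = Real.exp (((n : ℝ) + 1) * Ω x) * ‖mderiv α f x‖ := by
  rw [weightedDeriv_apply, norm_mul, Complex.norm_real, Real.norm_of_nonneg (Real.exp_pos _).le]

lemma norm_weightedDeriv (hΩ : Continuous Ω) (n : ℕ) (α : Fin N → ℕ)
    (f : weightedSmoothSubmodule Ω) : ‖weightedDeriv hΩ n α f‖ = weightedSup Ω n α f := by
  simp only [BoundedContinuousFunction.norm_eq_iSup_norm, norm_weightedDeriv_apply, weightedSup]

variable {P : Type*} [TopologicalSpace P] {W : P → ℝ} {ψ : P → weightedSmoothSubmodule Ω}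

lemma ModerateFamily.continuous_weightedDeriv
    (hψ : ModerateFamily Ω W fun p => (ψ p : EuclideanSpace ℝ (Fin N) → ℂ))
    (hΩ : IsAdmissible Ω) (hW : Continuous W) (n : ℕ) (α : Fin N → ℕ) :
    Continuous fun p => weightedDeriv hΩ.continuous n α (ψ p) := by
  refine continuous_of_eventually_norm_le ?_ fun p₀ ε hε => ?_
  · have := (hψ.mderiv α).continuous
    have := hΩ.continuous
    simp only [weightedDeriv_apply]
    fun_prop
  · simpa only [norm_weightedDeriv_apply] using
      (hψ.mderiv α).exists_isCompact_bound hΩ hW (by positivity : 0 < (n : ℝ) + 1) p₀ hε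

variable [MeasurableSpace P] [OpensMeasurableSpace P] [SecondCountableTopology P]
  {μ : Measure P} {b : P → ℂ}

lemma ModerateFamily.integrable_weightedDeriv
    (hψ : ModerateFamily Ω W fun p => (ψ p : EuclideanSpace ℝ (Fin N) → ℂ))
    (hΩ : IsAdmissible Ω) (hW : Continuous W) (hb : ExpIntegrable W b μ) (n : ℕ)
    (α : Fin N → ℕ) :
    Integrable (fun p => b p • weightedDeriv hΩ.continuous n α (ψ p)) μ := by
  obtain ⟨B, hB, h⟩ :=
    (hψ.mderiv α).exists_integrable_bound hb (by positivity : 0 < (n : ℝ) + 1)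
  refine hB.mono' (hb.integrable.aestronglyMeasurable.smul
    (hψ.continuous_weightedDeriv hΩ hW n α).aestronglyMeasurable) (.of_forall fun p => ?_)
  refine (BoundedContinuousFunction.norm_le_of_nonempty).2 fun t => ?_
  rw [BoundedContinuousFunction.smul_apply, norm_smul, norm_weightedDeriv_apply, mul_left_comm,
    ← norm_mul]
  exact h p t

lemma ModerateFamily.weightedDeriv_eq_integral
    (hψ : ModerateFamily Ω W fun p => (ψ p : EuclideanSpace ℝ (Fin N) → ℂ))
    (hΩ : IsAdmissible Ω) (hW : Continuous W) (hb : ExpIntegrable W b μ)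
    {u : weightedSmoothSubmodule Ω} (hu : (u : EuclideanSpace ℝ (Fin N) → ℂ) =
      fun t => ∫ p, b p * (ψ p : EuclideanSpace ℝ (Fin N) → ℂ) t ∂μ) (n : ℕ) (α : Fin N → ℕ) :
    weightedDeriv hΩ.continuous n α u =
      ∫ p, b p • weightedDeriv hΩ.continuous n α (ψ p) ∂μ := by
  ext t
  have eval_integral := (BoundedContinuousFunction.evalCLM ℂ t).integral_comp_comm
    (hψ.integrable_weightedDeriv hΩ hW hb n α)
  simp only [BoundedContinuousFunction.evalCLM_apply, BoundedContinuousFunction.smul_apply,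
    smul_eq_mul] at eval_integral
  rw [← eval_integral, weightedDeriv_apply, hu, hψ.mderiv_integral hΩ.nonneg hb,
    ← integral_const_mul]
  simp only [weightedDeriv_apply, mul_left_comm]

end WeightedDeriv

section Space

variable {N : ℕ} {ω σ : Fin N → WeightFunction}

/-- The inclusion of `S_Ω^Σ` into the functions satisfying the conditions at `Ω`. -/
def Space.toWeightedSmooth : Space ω σ →ₗ[ℂ] weightedSmoothSubmodule (directSum ω) where
  toFun φ := ⟨φ, φ.2.2.1⟩
  map_add' _ _ := rfl
  map_smul' _ _ := rfl

/-- The Fourier transform on `S_Ω^Σ`. -/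
def Space.fourier : Space ω σ →ₗ[ℂ] weightedSmoothSubmodule (directSum σ) where
  toFun φ := ⟨fourierT φ, φ.2.2.2⟩
  map_add' φ χ := Subtype.ext (fourierT_add φ.2.1 χ.2.1)
  map_smul' c φ := Subtype.ext (fourierT_smul c φ)

/-- A linear map into the bounded continuous functions inducing the `i`-th seminorm of
`S_Ω^Σ`. -/
def Space.component (i : (ℕ × (Fin N → ℕ)) ⊕ (ℕ × (Fin N → ℕ))) :
    Space ω σ →ₗ[ℂ] (EuclideanSpace ℝ (Fin N) →ᵇ ℂ) :=
  i.elim (fun r => weightedDeriv (continuous_directSum ω) r.1 r.2 ∘ₗ Space.toWeightedSmooth)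
    (fun r => weightedDeriv (continuous_directSum σ) r.1 r.2 ∘ₗ Space.fourier)

lemma Space.norm_component (i : (ℕ × (Fin N → ℕ)) ⊕ (ℕ × (Fin N → ℕ))) (φ : Space ω σ) :
    ‖Space.component i φ‖ = seminorms ω σ i φ := by
  rcases i with r | r
  · exact norm_weightedDeriv (continuous_directSum ω) r.1 r.2 φ.toWeightedSmooth
  · exact norm_weightedDeriv (continuous_directSum σ) r.1 r.2 φ.fourier

/-- Families in `S_Ω^Σ` which are moderate along with their Fourier transforms: every
ultradistribution commutes with their integrals against `ExpIntegrable` coefficients. -/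
structure Space.Moderate {P : Type*} [TopologicalSpace P] (W : P → ℝ) (ψ : P → Space ω σ) :
    Prop where
  left : ModerateFamily (directSum ω) W fun p => ψ p
  right : ModerateFamily (directSum σ) W fun p => fourierT (ψ p)

namespace Space.Moderate

variable {P : Type*} [TopologicalSpace P] {W : P → ℝ} {ψ : P → Space ω σ}

lemma continuous_apply (hψ : Space.Moderate W ψ) (hW : Continuous W)
    (f : Ultradistribution ω σ) : Continuous fun p => f (ψ p) := by
  refine continuous_apply_of_seminorms (withSeminorms ω σ) Space.norm_component f ?_
  rintro (r | r)
  · exact hψ.left.continuous_weightedDeriv (ψ := fun p => Space.toWeightedSmooth (ψ p))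
      (isAdmissible_directSum ω) hW r.1 r.2
  · exact hψ.right.continuous_weightedDeriv (ψ := fun p => Space.fourier (ψ p))
      (isAdmissible_directSum σ) hW r.1 r.2

variable [MeasurableSpace P] [OpensMeasurableSpace P] [SecondCountableTopology P]
  {μ : Measure P} [SFinite μ] {b : P → ℂ}

/-- The superposition `∫ b(p) ψ(p) dμ(p)` of a moderate family, as an element of `S_Ω^Σ`. -/
def integral (hψ : Space.Moderate W ψ) (hb : ExpIntegrable W b μ) : Space ω σ :=
  have h_smooth := hψ.left.weightedSmooth_integral (directSum_nonneg ω) hb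
  ⟨fun t => ∫ p, b p * ψ p t ∂μ,
    (RapidDecay.expIntegrable h_smooth.bound (isAdmissible_directSum ω)
      h_smooth.1.continuous).integrable, h_smooth, by
    rw [hψ.left.fourierT_integral (isAdmissible_directSum ω) hb]
    exact hψ.right.weightedSmooth_integral (directSum_nonneg σ) hb⟩

lemma map_integral (hψ : Space.Moderate W ψ) (hb : ExpIntegrable W b μ) (hW : Continuous W)
    (f : Ultradistribution ω σ) : f (hψ.integral hb) = ∫ p, b p * f (ψ p) ∂μ := by
  have hω := isAdmissible_directSum ω
  have hσ := isAdmissible_directSum σ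
  have h_int (i) : Integrable (fun p => Space.component i (b p • ψ p)) μ ∧
      Space.component i (hψ.integral hb) = ∫ p, Space.component i (b p • ψ p) ∂μ := by
    simp only [map_smul]
    rcases i with r | r
    · have h_left : ModerateFamily (directSum ω) W
          fun p => (Space.toWeightedSmooth (ψ p) : EuclideanSpace ℝ (Fin N) → ℂ) := hψ.left
      exact ⟨h_left.integrable_weightedDeriv hω hW hb r.1 r.2,
        h_left.weightedDeriv_eq_integral hω hW hb rfl r.1 r.2⟩
    · have h_right : ModerateFamily (directSum σ) W
          fun p => (Space.fourier (ψ p) : EuclideanSpace ℝ (Fin N) → ℂ) := hψ.right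
      exact ⟨h_right.integrable_weightedDeriv hσ hW hb r.1 r.2,
        h_right.weightedDeriv_eq_integral hσ hW hb
          (hψ.left.fourierT_integral hω hb) r.1 r.2⟩
  simpa only [map_smul, smul_eq_mul] using apply_eq_integral_of_seminorms (withSeminorms ω σ)
    Space.norm_component f (fun i => (h_int i).1) fun i => (h_int i).2

end Space.Moderate

end Space

lemma integral_mul_conj_ne_zero {X : Type*} [TopologicalSpace X] [MeasurableSpace X]
    {μ : Measure X} [μ.IsOpenPosMeasure] {u : X → ℂ} (hc : Continuous u)
    (hu : Integrable (fun x => u x * (starRingEnd ℂ) (u x)) μ) (h₀ : u ≠ 0) :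
    ∫ x, u x * (starRingEnd ℂ) (u x) ∂μ ≠ 0 := by
  simp only [Complex.mul_conj] at hu ⊢
  obtain ⟨x, hx⟩ := Function.ne_iff.1 h₀
  rw [integral_complex_ofReal, Complex.ofReal_ne_zero]
  exact (integral_pos_of_integrable_nonneg_nonzero (Complex.continuous_normSq.comp hc) hu.re
    (fun x => Complex.normSq_nonneg _) (Complex.normSq_pos.2 hx).ne').ne'

variable {N : ℕ} {ω σ : Fin N → WeightFunction}

section Functional

lemma Space.continuous (g : Space ω σ) : Continuous g := g.2.2.1.1.continuous

lemma Space.integrable_fourierT (g : Space ω σ) : Integrable (fourierT g) :=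
  (RapidDecay.expIntegrable g.2.2.2.bound (isAdmissible_directSum σ)
    g.2.2.2.1.continuous).integrable

lemma Space.norm_apply_le_seminorms (φ : Space ω σ) (t : EuclideanSpace ℝ (Fin N)) :
    ‖φ t‖ ≤ seminorms ω σ (Sum.inl (0, 0)) φ := by
  refine le_trans ?_ (le_ciSup (bddAbove_of_weightedSmooth φ.2.2.1 0 0) t)
  have := directSum_nonneg ω t
  rw [mderiv_zero]
  exact le_mul_of_one_le_left (norm_nonneg _) (Real.one_le_exp (by positivity))

lemma Space.integrable_mul (h φ : Space ω σ) : Integrable fun t => h t * φ t :=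
  h.2.1.mul_bdd φ.continuous.aestronglyMeasurable (.of_forall φ.norm_apply_le_seminorms)

/-- The functional `φ ↦ ∫ h φ`, through which `h ∈ S_Ω^Σ` is regarded as an ultradistribution. -/
def Space.toUltradistribution (h : Space ω σ) : Ultradistribution ω σ :=
  let pairing : Space ω σ →ₗ[ℂ] ℂ :=
    { toFun := fun φ => ∫ t, h t * φ t
      map_add' := fun φ χ => by
        rw [← integral_add (h.integrable_mul φ) (h.integrable_mul χ)]
        exact integral_congr_ae (.of_forall fun t => mul_add _ _ _)
      map_smul' := fun c φ => by
        rw [RingHom.id_apply, smul_eq_mul, ← integral_const_mul]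
        exact integral_congr_ae (.of_forall fun t => mul_left_comm _ _ _) }
  { pairing with
    cont := by
      refine (withSeminorms ω σ).continuous_normedSpace_rng ℂ pairing
        ⟨{Sum.inl (0, 0)}, ⟨∫ t, ‖h t‖, integral_nonneg fun t => norm_nonneg _⟩, fun φ => ?_⟩
      rw [Finset.sup_singleton]
      have norm_mul_le (t : EuclideanSpace ℝ (Fin N)) :
          ‖h t * φ t‖ ≤ ‖h t‖ * seminorms ω σ (Sum.inl (0, 0)) φ := by
        rw [norm_mul]
        exact mul_le_mul_of_nonneg_left (φ.norm_apply_le_seminorms t) (norm_nonneg _)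
      exact (norm_integral_le_of_norm_le (h.2.1.norm.mul_const _) (.of_forall norm_mul_le)).trans_eq
        (integral_mul_const _ _) }

lemma Space.toUltradistribution_apply (h φ : Space ω σ) :
    h.toUltradistribution φ = ∫ t, h t * φ t := rfl

lemma Space.toUltradistribution_comm (h φ : Space ω σ) :
    h.toUltradistribution φ = φ.toUltradistribution h := by
  simp only [toUltradistribution_apply, mul_comm]

lemma Ultradistribution.belongsToSpace_iff (f : Ultradistribution ω σ) :
    f.BelongsToSpace ↔ ∃ h : Space ω σ, f = h.toUltradistribution :=
  exists_congr fun h => (ContinuousLinearMap.ext_iff (f := f) (g := h.toUltradistribution)).symm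

end Functional

section TimeFrequencyShift

/-- Complex conjugation on `S_Ω^Σ`. -/
def Space.conj (g : Space ω σ) : Space ω σ :=
  ⟨fun t => (starRingEnd ℂ) (g t), Complex.conjCLE.toContinuousLinearMap.integrable_comp g.2.1,
    g.2.2.1.conj, by rw [fourierT_conj]; exact g.2.2.2.reflect.conj⟩

lemma coe_conjShift (g : Space ω σ) (x ξ : EuclideanSpace ℝ (Fin N)) :
    (conjShift g x ξ : EuclideanSpace ℝ (Fin N) → ℂ) = phase ξ * fun t => g.conj (t - x) := rfl

lemma fourierT_phase_mul_comp_sub (u : EuclideanSpace ℝ (Fin N) → ℂ)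
    (x ξ : EuclideanSpace ℝ (Fin N)) : fourierT (phase ξ * fun t => u (t - x)) =
      phase x ξ • (phase x * fun η => fourierT u (η - -ξ)) := by
  have h_mod := fourierT_modulate (fun t => u (t - x)) ξ
  rw [fourierT_translate] at h_mod
  refine h_mod.trans (funext fun η => ?_)
  have phase_add : Complex.exp (-(Complex.I * (inner ℝ (η - -ξ) x : ℝ))) =
      phase x ξ * phase x η := by
    rw [phase, phase, ← Complex.exp_add, sub_neg_eq_add, inner_add_left]
    push_cast
    ring_nf
  simp only [phase_add, Pi.smul_apply, Pi.mul_apply, smul_eq_mul, mul_assoc]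

lemma moderate_conjShift (g : Space ω σ) {P : Type*} [TopologicalSpace P] {W : P → ℝ}
    {y ζ : P → EuclideanSpace ℝ (Fin N)} (hy : Continuous y) (hζ : Continuous ζ)
    (hyW : ∀ p, directSum ω (y p) ≤ W p) (hζW : ∀ p, directSum σ (ζ p) ≤ W p) :
    Space.Moderate W fun p => conjShift g (y p) (ζ p) := by
  have hω := isAdmissible_directSum ω
  have hσ := isAdmissible_directSum σ
  have hW (p : P) : 0 ≤ W p := (hω.nonneg _).trans (hyW p)
  have norm_coord_le (v : EuclideanSpace ℝ (Fin N)) (j : Fin N) : ‖-(v j : ℂ)‖ ≤ ‖v‖ := by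
    simpa using PiLp.norm_apply_le v j
  refine ⟨(g.conj.2.2.1.moderateFamily_comp_sub hω hy hyW).phase_mul hW hζ fun j =>
    hσ.moderateGrowth hζW fun p => norm_coord_le _ j, ?_⟩
  have h_right : ModerateFamily (directSum σ) W fun p => phase (y p) * fun η =>
      fourierT g.conj (η - -ζ p) :=
    (g.conj.2.2.2.moderateFamily_comp_sub hσ hζ.neg fun p => (hσ.neg _).trans_le (hζW p)).phase_mul
      hW hy fun j => hω.moderateGrowth hyW fun p => norm_coord_le _ j
  simpa only [coe_conjShift, fourierT_phase_mul_comp_sub] using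
    h_right.smul (q := fun p => phase (y p) (ζ p)) (by fun_prop)
      ⟨1, 0, zero_le_one, fun p => by simp [norm_phase]⟩

/-- The time-frequency shift `t ↦ exp(i t·ξ) g(t - x)`, for `p = (x, ξ)`. -/
def timeFreqShift (g : Space ω σ) (p : EuclideanSpace ℝ (Fin N) × EuclideanSpace ℝ (Fin N)) :
    Space ω σ :=
  conjShift g.conj p.1 (-p.2)

lemma timeFreqShift_apply (g : Space ω σ)
    (p : EuclideanSpace ℝ (Fin N) × EuclideanSpace ℝ (Fin N)) (t : EuclideanSpace ℝ (Fin N)) :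
    timeFreqShift g p t = phase (-p.2) t * g (t - p.1) :=
  congrArg (phase (-p.2) t * ·) (Complex.conj_conj _)

/-- The weight `Ω ⊕ Σ` on phase space. -/
def phaseWeight (ω σ : Fin N → WeightFunction)
    (p : EuclideanSpace ℝ (Fin N) × EuclideanSpace ℝ (Fin N)) : ℝ :=
  directSum ω p.1 + directSum σ p.2

lemma isAdmissible_phaseWeight (ω σ : Fin N → WeightFunction) :
    IsAdmissible (phaseWeight ω σ) :=
  (isAdmissible_directSum ω).prod (isAdmissible_directSum σ)

lemma moderate_phaseSpace_conjShift (g : Space ω σ) :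
    Space.Moderate (phaseWeight ω σ) fun p => conjShift g p.1 p.2 :=
  moderate_conjShift g continuous_fst continuous_snd
    (fun p => le_add_of_nonneg_right (directSum_nonneg σ p.2))
    fun p => le_add_of_nonneg_left (directSum_nonneg ω p.1)

lemma moderate_timeFreqShift (g : Space ω σ) :
    Space.Moderate (phaseWeight ω σ) (timeFreqShift g) :=
  moderate_conjShift g.conj continuous_fst continuous_snd.neg
    (fun p => le_add_of_nonneg_right (directSum_nonneg σ p.2))
    fun p => (directSum_neg σ p.2).trans_le (le_add_of_nonneg_left (directSum_nonneg ω p.1))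

end TimeFrequencyShift

section ShortTimeFourierTransform

lemma continuous_stft (g : Space ω σ) (f : Ultradistribution ω σ) :
    Continuous fun p : EuclideanSpace ℝ (Fin N) × EuclideanSpace ℝ (Fin N) =>
      stft g f p.1 p.2 :=
  (moderate_phaseSpace_conjShift g).continuous_apply (isAdmissible_phaseWeight ω σ).continuous f

lemma norm_stft_toUltradistribution_le_left (h g : Space ω σ) (x ξ : EuclideanSpace ℝ (Fin N)) :
    ‖stft g h.toUltradistribution x ξ‖ ≤ ∫ t, ‖h t‖ * ‖g (t - x)‖ := by
  refine (norm_integral_le_integral_norm _).trans_eq (integral_congr_ae (.of_forall fun t => ?_))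
  simp only [coe_conjShift, Pi.mul_apply, norm_mul, norm_phase, one_mul, Space.conj,
    RCLike.norm_conj]

lemma norm_stft_toUltradistribution_le_right (h g : Space ω σ) (x ξ : EuclideanSpace ℝ (Fin N)) :
    ‖stft g h.toUltradistribution x ξ‖ ≤ ∫ η, ‖fourierT h η‖ * ‖fourierT g (η - ξ)‖ := by
  have norm_fourierT_conjShift (η : EuclideanSpace ℝ (Fin N)) :
      ‖fourierT (conjShift g x ξ) (-η)‖ = ‖fourierT g (η - ξ)‖ := by
    rw [coe_conjShift, fourierT_phase_mul_comp_sub, Pi.smul_apply, norm_smul, Pi.mul_apply,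
      norm_mul, norm_phase, norm_phase, one_mul, one_mul]
    refine (congrArg norm (congrFun (fourierT_conj g) _)).trans ?_
    rw [RCLike.norm_conj, sub_neg_eq_add, neg_add, neg_neg, sub_eq_add_neg]
  have one_le : 1 ≤ ‖(2 * Real.pi : ℂ) ^ N‖ := by
    rw [norm_pow, norm_mul, Complex.norm_real, Complex.norm_ofNat,
      Real.norm_of_nonneg Real.pi_pos.le]
    exact one_le_pow₀ (by linarith [Real.two_le_pi])
  calc ‖stft g h.toUltradistribution x ξ‖
      ≤ ‖(2 * Real.pi : ℂ) ^ N * ∫ t, h t * conjShift g x ξ t‖ := by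
        rw [norm_mul]
        exact le_mul_of_one_le_left (norm_nonneg _) one_le
    _ = ‖∫ η, fourierT h η * fourierT (conjShift g x ξ) (-η)‖ := by
        rw [integral_mul_eq_integral_fourierT h.continuous h.2.1 h.integrable_fourierT
          (conjShift g x ξ).2.1]
    _ ≤ ∫ η, ‖fourierT h η * fourierT (conjShift g x ξ) (-η)‖ := norm_integral_le_integral_norm _
    _ = ∫ η, ‖fourierT h η‖ * ‖fourierT g (η - ξ)‖ := by
        simp only [norm_mul, norm_fourierT_conjShift]

lemma rapidDecay_stft_right (h g : Space ω σ) (x : EuclideanSpace ℝ (Fin N)) :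
    RapidDecay (directSum σ) (stft g h.toUltradistribution x) :=
  (RapidDecay.integral_norm_mul_norm_sub (isAdmissible_directSum σ) h.2.2.2.bound
    g.2.2.2.bound).comp_norm_le fun ξ =>
      (norm_stft_toUltradistribution_le_right h g x ξ).trans (Real.le_norm_self _)

lemma rapidDecay_stft (h g : Space ω σ) :
    RapidDecay (phaseWeight ω σ) fun p => stft g h.toUltradistribution p.1 p.2 :=
  (RapidDecay.integral_norm_mul_norm_sub (isAdmissible_directSum ω) h.2.2.1.bound
    g.2.2.1.bound).prod
    (RapidDecay.integral_norm_mul_norm_sub (isAdmissible_directSum σ) h.2.2.2.bound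
      g.2.2.2.bound)
    (fun p => (norm_stft_toUltradistribution_le_left h g p.1 p.2).trans (Real.le_norm_self _))
    fun p => (norm_stft_toUltradistribution_le_right h g p.1 p.2).trans (Real.le_norm_self _)

/-- The coefficient `⟨φ, exp(i t·ξ) g(t - x)⟩` of `φ`, for `p = (x, ξ)`. -/
def timeFreqCoeff (g φ : Space ω σ)
    (p : EuclideanSpace ℝ (Fin N) × EuclideanSpace ℝ (Fin N)) : ℂ :=
  φ.toUltradistribution (timeFreqShift g p)

lemma timeFreqCoeff_eq_stft (g φ : Space ω σ)
    (p : EuclideanSpace ℝ (Fin N) × EuclideanSpace ℝ (Fin N)) :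
    timeFreqCoeff g φ p = stft g.conj φ.toUltradistribution p.1 (-p.2) := rfl

lemma timeFreqCoeff_eq_fourierT (g φ : Space ω σ)
    (p : EuclideanSpace ℝ (Fin N) × EuclideanSpace ℝ (Fin N)) :
    timeFreqCoeff g φ p = fourierT (fun t => φ t * g (t - p.1)) (-p.2) := by
  refine integral_congr_ae (.of_forall fun t => ?_)
  simp only [timeFreqShift_apply]
  exact mul_left_comm _ _ _

lemma expIntegrable_timeFreqCoeff (g φ : Space ω σ) :
    ExpIntegrable (phaseWeight ω σ) (timeFreqCoeff g φ) (volume.prod volume) := by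
  refine RapidDecay.expIntegrable (fun l hl => ?_) (isAdmissible_phaseWeight ω σ)
    ((moderate_timeFreqShift g).continuous_apply (isAdmissible_phaseWeight ω σ).continuous _)
  refine (rapidDecay_stft φ g.conj l hl).imp fun C hC p => ?_
  simpa only [phaseWeight, directSum_neg, timeFreqCoeff_eq_stft] using hC (p.1, -p.2)

lemma integrable_fourierT_mul_comp_sub (g φ : Space ω σ) (x : EuclideanSpace ℝ (Fin N)) :
    Integrable (fourierT fun t => φ t * g (t - x)) := by
  have stft_eq_fourierT (ξ : EuclideanSpace ℝ (Fin N)) :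
      stft g.conj φ.toUltradistribution x ξ = fourierT (fun t => φ t * g (t - x)) ξ := by
    simpa only [timeFreqCoeff_eq_stft, neg_neg] using timeFreqCoeff_eq_fourierT g φ (x, -ξ)
  have h_cont : Continuous (stft g.conj φ.toUltradistribution x) :=
    Continuous.uncurry_left x (continuous_stft g.conj φ.toUltradistribution)
  have h_int : Integrable (stft g.conj φ.toUltradistribution x) :=
    ((rapidDecay_stft_right φ g.conj x).expIntegrable (isAdmissible_directSum σ)
      h_cont).integrable
  rwa [funext stft_eq_fourierT] at h_int

lemma integral_timeFreqCoeff_mul_conjShift (g φ : Space ω σ) (x t : EuclideanSpace ℝ (Fin N)) :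
    ∫ ξ, timeFreqCoeff g φ (x, ξ) * conjShift g x ξ t =
      (2 * Real.pi : ℂ) ^ N * (φ t * (g (t - x) * (starRingEnd ℂ) (g (t - x)))) := by
  set u : EuclideanSpace ℝ (Fin N) → ℂ := fun t => φ t * g (t - x)
  have hc : Continuous u := φ.continuous.mul (g.continuous.comp (continuous_sub_right x))
  have hu : Integrable u := by
    have := φ.integrable_mul (timeFreqShift g (x, 0))
    simpa [timeFreqShift_apply, phase] using this
  have inversion : ∫ ξ, phase t ξ * fourierT u (-ξ) = (2 * Real.pi : ℂ) ^ N * u t := by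
    rw [← neg_neg t, ← fourierT_fourierT hc hu (integrable_fourierT_mul_comp_sub g φ x),
      ← fourierT_comp_neg, neg_neg]
    rfl
  calc ∫ ξ, timeFreqCoeff g φ (x, ξ) * conjShift g x ξ t
      = ∫ ξ, phase t ξ * fourierT u (-ξ) * (starRingEnd ℂ) (g (t - x)) := by
        refine integral_congr_ae (.of_forall fun ξ => ?_)
        simp only [timeFreqCoeff_eq_fourierT, coe_conjShift, Pi.mul_apply, phase, real_inner_comm]
        exact mul_left_comm _ _ _ |>.trans (mul_assoc _ _ _).symm
    _ = _ := by rw [integral_mul_const, inversion]; ring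

/-- The constant `(2π)^N ‖g‖²` of the inversion formula, with the norm of `L²`. -/
def stftConst (g : Space ω σ) : ℂ :=
  (2 * Real.pi : ℂ) ^ N * ∫ t, g t * (starRingEnd ℂ) (g t)

lemma stftConst_ne_zero {g : Space ω σ} (hg : g ≠ 0) : stftConst g ≠ 0 :=
  mul_ne_zero (pow_ne_zero _ (by simp [Real.pi_ne_zero]))
    (integral_mul_conj_ne_zero g.continuous (g.integrable_mul g.conj)
      fun h => hg (Subtype.ext h))

lemma integral_timeFreqCoeff_conjShift (g φ : Space ω σ) :
    (moderate_phaseSpace_conjShift g).integral (expIntegrable_timeFreqCoeff g φ) =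
      stftConst g • φ := by
  refine Subtype.ext (funext fun t => ?_)
  calc ∫ p, timeFreqCoeff g φ p * conjShift g p.1 p.2 t ∂(volume.prod volume)
      = ∫ x, ∫ ξ, timeFreqCoeff g φ (x, ξ) * conjShift g x ξ t :=
        integral_prod _ ((moderate_phaseSpace_conjShift g).left.isModerate.integrable_mul
          (directSum_nonneg ω) (expIntegrable_timeFreqCoeff g φ) t)
    _ = (2 * Real.pi : ℂ) ^ N * (φ t * ∫ x, g (t - x) * (starRingEnd ℂ) (g (t - x))) := by
        simp only [integral_timeFreqCoeff_mul_conjShift, integral_const_mul]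
    _ = stftConst g * φ t := by
        rw [stftConst, integral_sub_left_eq_self (fun x => g x * (starRingEnd ℂ) (g x)) volume t]
        ring

lemma stftConst_smul_eq_toUltradistribution {g : Space ω σ} {f : Ultradistribution ω σ}
    (hf : ExpIntegrable (phaseWeight ω σ) (fun p => stft g f p.1 p.2) (volume.prod volume)) :
    stftConst g • f = ((moderate_timeFreqShift g).integral hf).toUltradistribution := by
  have hW := (isAdmissible_phaseWeight ω σ).continuous
  ext φ
  calc stftConst g • f φ
      = f ((moderate_phaseSpace_conjShift g).integral (expIntegrable_timeFreqCoeff g φ)) := by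
        rw [integral_timeFreqCoeff_conjShift, map_smul]
    _ = ∫ p, timeFreqCoeff g φ p * stft g f p.1 p.2 ∂(volume.prod volume) :=
        (moderate_phaseSpace_conjShift g).map_integral (expIntegrable_timeFreqCoeff g φ) hW f
    _ = φ.toUltradistribution ((moderate_timeFreqShift g).integral hf) := by
        rw [(moderate_timeFreqShift g).map_integral hf hW]
        simp only [mul_comm, timeFreqCoeff]
    _ = ((moderate_timeFreqShift g).integral hf).toUltradistribution φ :=
        φ.toUltradistribution_comm _

lemma Space.toUltradistribution_smul (c : ℂ) (h : Space ω σ) :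
    (c • h).toUltradistribution = c • h.toUltradistribution := by
  ext φ
  exact (integral_congr_ae (.of_forall fun t => mul_assoc _ _ _)).trans (integral_const_mul _ _)

theorem belongsToSpace_iff_rapidDecay_stft {g : Space ω σ} (hg : g ≠ 0)
    (f : Ultradistribution ω σ) :
    f.BelongsToSpace ↔ RapidDecay (phaseWeight ω σ) fun p => stft g f p.1 p.2 := by
  rw [f.belongsToSpace_iff]
  constructor
  · rintro ⟨h, rfl⟩
    exact rapidDecay_stft h g
  · intro h_decay
    have hf := h_decay.expIntegrable (isAdmissible_phaseWeight ω σ) (continuous_stft g f)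
      (μ := volume.prod volume)
    refine ⟨(stftConst g)⁻¹ • (moderate_timeFreqShift g).integral hf, ?_⟩
    rw [Space.toUltradistribution_smul, eq_inv_smul_iff₀ (stftConst_ne_zero hg)]
    exact stftConst_smul_eq_toUltradistribution hf

end ShortTimeFourierTransform

end Beurling

end

theorem mainTheorem5 (N : ℕ) (ω σ : Fin N → Beurling.WeightFunction)
    (g : Beurling.Space ω σ) (hg : g ≠ 0) (f : Beurling.Ultradistribution ω σ) :
    f.BelongsToSpace ↔
      ∀ l : ℝ, 0 < l → ∃ C : ℝ, 0 < C ∧ ∀ x ξ : EuclideanSpace ℝ (Fin N),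
        ‖Beurling.stft g f x ξ‖ ≤
          C * Real.exp (-l * (Beurling.directSum ω x + Beurling.directSum σ ξ)) := by
  rw [Beurling.belongsToSpace_iff_rapidDecay_stft hg, Beurling.rapidDecay_iff]
  simp only [Prod.forall, Beurling.phaseWeight]
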